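/- Conventions. A \emph{unital locally $C^*$-algebra} is a unital complex $*$-algebra $\mathcal A$ with a complete Hausdorff topology determined by a family $\{p_\lambda\}_{\lambda\in\Lambda}$ of $C^*$-seminorms indexed by a non-empty directed poset $\Lambda$, with $p_{\lambda_1}\le p_{\lambda_2}$ whenever $\lambda_1\le\lambda_2$. For $a\in M_n(\mathcal A)$ write $a=_\lambda 0$ if $p_\lambda(a_{ij})=0$ for all $i,j$, and $a\ge_\lambda 0$ if $a=b^*b+c$ with $b,c\in M_n(\mathcal A)$ and $c=_\lambda 0$. A \emph{local operator system} in $\mathcal A$ is a self-adjoint linear subspace $\mathcal S\subseteq\mathcal A$ containing $1$; it \emph{generates} $\mathcal A$ if the $*$-subalgebra generated by $\mathcal S$ is dense in $\mathcal A$. Hilbert spaces are complex. For a linear subspace $\mathcal T\subseteq\mathcal A$ and a Hilbert space $\mathcal H$, a linear map $\varphi:\mathcal T\to B(\mathcal H)$ is a \emph{local $\mathcal{CP}$-map} if there is $\lambda\in\Lambda$ such that for all $n\ge 1$ and all $a=[a_{ij}]\in M_n(\mathcal T)$: $[\varphi(a_{ij})]\ge 0$ in $B(\mathcal H^{\oplus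 n})$ whenever $a\ge_\lambda 0$ in $M_n(\mathcal A)$, and $[\varphi(a_{ij})]=0$ whenever $a=_\lambda 0$. A local $\mathcal{CP}$-map $\varphi$ on $\mathcal T$ is \emph{pure} if every local $\mathcal{CP}$-map $\psi:\mathcal T\to B(\mathcal H)$ for which $\varphi-\psi$ is a local $\mathcal{CP}$-map is of the form $\psi=t\varphi$ with $t\in[0,1]$. A \emph{local representation} of $\mathcal A$ on a Hilbert space $\mathcal H$ is a unital $*$-homomorphism $\pi:\mathcal A\to B(\mathcal H)$ for which there is $\lambda\in\Lambda$ with $\|\pi(a)\|\le p_\lambda(a)$ for all $a\in\mathcal A$. It is \emph{irreducible} if the only operators in $B(\mathcal H)$ commuting with $\pi(\mathcal A)$ are the scalar multiples of the identity. A \emph{local boundary representation} for $\mathcal S$ is an irreducible local representation $\pi$ of $\mathcal A$ that is the unique local $\mathcal{CP}$-map $\mathcal A\to B(\mathcal H)$ extending $\pi|_{\mathcal S}$. A local representation $\pi$ on $\mathcal H$ is \emph{finite for} $\mathcal S$ if every isometry $V\in B(\mathcal H)$ with $\pi(a)=V^*\pi(a)V$ for all $a\in\mathcal S$ is unitary.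 $\mathcal S$ \emph{separates} an irreducible local representation $\pi$ on $\mathcal H$ if, whenever $\rho:\mathcal A\to B(\mathcal K)$ is an irreducible local representation on a Hilbert space $\mathcal K$ and $V:\mathcal H\to\mathcal K$ is an isometry with $\pi(a)=V^*\rho(a)V$ for all $a\in\mathcal S$, the representations $\pi$ and $\rho$ are unitarily equivalent. Theorem. Let $\mathcal A$ be a unital locally $C^*$-algebra with topology determined by $\{p_\lambda\}_{\lambda\in\Lambda}$, let $\mathcal S$ be a local operator system in $\mathcal A$ that generates $\mathcal A$, and let $\pi:\mathcal A\to B(\mathcal H)$ be an irreducible local representation on a Hilbert space $\mathcal H\ne 0$. Then $\pi$ is a local boundary representation for $\mathcal S$ if and only if all of the following hold: (1) $\pi|_{\mathcal S}$ is a pure local $\mathcal{CP}$-map; (2) $\pi$ is a finite local representation for $\mathcal S$; (3) $\mathcal S$ separates $\pi$. -/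

import Mathlib

open scoped ComplexOrder Matrix

namespace LocalCStar

universe u v w

section Algebra

variable {A : Type u} [Ring A] [StarRing A] [Algebra ℂ A] [StarModule ℂ A]
variable {Λ : Type v}

/-- `A` is a (unital) locally C*-algebra whose topology is determined by the upward filtered
family `p` of C*-seminorms: `A` is Hausdorff and complete, and its topology is the one generated
by `p`. -/
structure IsLocallyCStarAlgebra [UniformSpace A] [IsUniformAddGroup A] [PartialOrder Λ]
    (p : Λ → Seminorm ℂ A) : Prop where
  nonempty : Nonempty Λ
  directed : IsDirectedOrder Λ
  mono : ∀ l₁ l₂ : Λ, l₁ ≤ l₂ → ∀ a, p l₁ a ≤ p l₂ a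
  mul_le : ∀ l a b, p l (a * b) ≤ p l a * p l b
  star_mul_self : ∀ l a, p l (star a * a) = p l a ^ 2
  withSeminorms : WithSeminorms p
  t2 : T2Space A
  complete : CompleteSpace A

/-- A local operator system in `A`: a self-adjoint linear subspace containing the unit. -/
structure IsLocalOperatorSystem (S : Submodule ℂ A) : Prop where
  one_mem : (1 : A) ∈ S
  star_mem : ∀ a ∈ S, star a ∈ S

/-- `S` generates `A` as a locally C*-algebra: the *-subalgebra generated by `S` is dense. -/
def Generates [TopologicalSpace A] (S : Submodule ℂ A) : Prop :=
  Dense (StarAlgebra.adjoin ℂ (S : Set A) : Set A)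

/-- `M =_l 0` in `Mₙ(A)`: the image of `M` in `Mₙ(A_l)`, `A_l = A / ker p_l`, is zero. -/
def MatrixLocallyZero (p : Λ → Seminorm ℂ A) (l : Λ) {n : ℕ}
    (M : Matrix (Fin n) (Fin n) A) : Prop :=
  ∀ i j, p l (M i j) = 0

/-- `M ≥_l 0` in `Mₙ(A)`: `M = B⋆ B + C` with `B, C ∈ Mₙ(A)` and `C =_l 0`. -/
def MatrixLocallyNonneg (p : Λ → Seminorm ℂ A) (l : Λ) {n : ℕ}
    (M : Matrix (Fin n) (Fin n) A) : Prop :=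
  ∃ B C : Matrix (Fin n) (Fin n) A, M = Bᴴ * B + C ∧ MatrixLocallyZero p l C

end Algebra

section Maps

variable {A : Type u} [Ring A] [StarRing A] [Algebra ℂ A] [StarModule ℂ A]
variable {Λ : Type v} (p : Λ → Seminorm ℂ A)
variable {H : Type w} [NormedAddCommGroup H] [InnerProductSpace ℂ H] [CompleteSpace H]

/-- An operator matrix `T ∈ Mₙ(B(H)) = B(H ⊕ ⋯ ⊕ H)` is positive:
`⟪ξ, T ξ⟫ ≥ 0` (real and nonnegative) for all `ξ ∈ H ⊕ ⋯ ⊕ H`. -/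
def OperatorMatrixNonneg {n : ℕ} (T : Matrix (Fin n) (Fin n) (H →L[ℂ] H)) : Prop :=
  ∀ ξ : Fin n → H, 0 ≤ ∑ i, ∑ j, inner ℂ (ξ i) (T i j (ξ j))

/-- `φ : S → B(H)` is a local completely positive map. The relations `≥_l` and `=_l` for
matrices over `S` are those of `Mₙ(A)`. -/
def IsLocalCP {S : Submodule ℂ A} (φ : S →ₗ[ℂ] (H →L[ℂ] H)) : Prop :=
  ∃ l : Λ, ∀ (n : ℕ) (M : Matrix (Fin n) (Fin n) S),
    (MatrixLocallyNonneg p l (M.map (fun a => (a : A))) → OperatorMatrixNonneg (M.map φ)) ∧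
    (MatrixLocallyZero p l (M.map (fun a => (a : A))) → M.map φ = 0)

/-- A pure local completely positive map `φ : S → B(H)`. -/
def IsPureLocalCP {S : Submodule ℂ A} (φ : S →ₗ[ℂ] (H →L[ℂ] H)) : Prop :=
  IsLocalCP p φ ∧
    ∀ ψ : S →ₗ[ℂ] (H →L[ℂ] H), IsLocalCP p ψ → IsLocalCP p (φ - ψ) →
      ∃ t : ℝ, 0 ≤ t ∧ t ≤ 1 ∧ ψ = (t : ℂ) • φ

/-- The restriction `π|_S` as a linear map. -/
def restrict (π : A →⋆ₐ[ℂ] (H →L[ℂ] H)) (S : Submodule ℂ A) : S →ₗ[ℂ] (H →L[ℂ] H) :=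
  π.toAlgHom.toLinearMap.domRestrict S

/-- A (unital) *-representation `π` of `A` on `H` is local. -/
def IsLocalRep (π : A →⋆ₐ[ℂ] (H →L[ℂ] H)) : Prop :=
  ∃ l : Λ, ∀ a, ‖π a‖ ≤ p l a

/-- An irreducible local representation: the commutant of `π(A)` in `B(H)` is `ℂ I`. -/
def IsIrreducibleLocalRep (π : A →⋆ₐ[ℂ] (H →L[ℂ] H)) : Prop :=
  IsLocalRep p π ∧
    ∀ T : H →L[ℂ] H, (∀ a, T * π a = π a * T) → ∃ c : ℂ, T = c • (1 : H →L[ℂ] H)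

/-- `π` is a local boundary representation for `S`: it is irreducible and it is the unique local
completely positive map on `A` extending `π|_S`. -/
def IsLocalBoundaryRep (S : Submodule ℂ A) (π : A →⋆ₐ[ℂ] (H →L[ℂ] H)) : Prop :=
  IsIrreducibleLocalRep p π ∧
    IsLocalCP p (restrict π ⊤) ∧
    ∀ ψ : (⊤ : Submodule ℂ A) →ₗ[ℂ] (H →L[ℂ] H), IsLocalCP p ψ →
      (∀ a : (⊤ : Submodule ℂ A), (a : A) ∈ S → ψ a = π a) → ψ = restrict π ⊤

/-- `π` is a finite local representation for `S`. -/
def IsFiniteLocalRep (S : Submodule ℂ A) (π : A →⋆ₐ[ℂ] (H →L[ℂ] H)) : Prop :=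
  IsLocalRep p π ∧
    ∀ V : H →L[ℂ] H, Isometry V →
      (∀ a ∈ S, π a = V.adjoint ∘L π a ∘L V) → V ∈ unitary (H →L[ℂ] H)

/-- `S` separates the irreducible local representation `π` of `A` on `H`. The universe of `K`
is large enough for every irreducible representation of `A`, up to unitary equivalence. -/
def Separates (S : Submodule ℂ A) (π : A →⋆ₐ[ℂ] (H →L[ℂ] H)) : Prop :=
  ∀ (K : Type (max u w)) [NormedAddCommGroup K] [InnerProductSpace ℂ K] [CompleteSpace K]
    (ρ : A →⋆ₐ[ℂ] (K →L[ℂ] K)) (V : H →L[ℂ] K),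
    IsIrreducibleLocalRep p ρ → Isometry V →
    (∀ a ∈ S, π a = V.adjoint ∘L ρ a ∘L V) →
    ∃ U : H ≃ₗᵢ[ℂ] K, ∀ a ξ, U (π a ξ) = ρ a (U ξ)

end Maps

end LocalCStar

/-! Both directions rest on dilations. Every local CP-map on `S` has the form `V⋆ ρ(·) V` with `ρ` a
local representation of `A`: this is Arveson's extension theorem combined with Stinespring's
construction (`IsCPAt.exists_dilation`). Positivity is tested in the C*-completion of `A` for a
single seminorm. The relation `≥_l` asks for a factor `B⋆B` over `A` itself, which completeness of
`A` supplies as a limit of polynomials (`matrixLocallyNonneg_iff`).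

A boundary representation satisfies (1)-(3) because compressions that add up to `π` have
intertwining compressing operators (`intertwines_of_compression_add`): `‖V π(b) ξ - ρ(b) V ξ‖²`
depends only on `V⋆ ρ(·) V`, and the sum of these expressions is the corresponding one for `π`,
which is zero. Uniqueness of the extension turns a relation on `S` into one on `A`, and
irreducibility makes `V`, `V V⋆` or `V₁⋆ V₁` scalar, giving finiteness, separation and purity
respectively.

Conversely, the extensions of `π|_S` that are CP for a fixed seminorm form a compact convex set
under pointwise convergence, so by Krein–Milman it suffices to show that each extreme point is `π`.
A self-adjoint `T` commuting with the minimal dilation `ρ` of an extreme point splits it along `1/2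
± εT`. By purity both pieces restrict to multiples of `π|_S`, so after rescaling they are again
extensions, and extremality forces `T` to be scalar. Hence `ρ` is irreducible. Separation identifies
`ρ` with `π`, finiteness makes the dilating isometry a unitary on `H`, and this unitary commutes
with `π(S)`, hence with `π(A)`, since `S` generates. -/

namespace LocalCStar

universe u v w

/-! ### C*-seminorms and their C*-completions. -/

section Completion

open UniformSpace

variable {A : Type u} [SeminormedRing A] [StarRing A] [NormedAlgebra ℂ A] [StarModule ℂ A]

/-- The completion of a complex *-algebra with a C*-seminorm is a C*-algebra. -/
noncomputable abbrev completionCStarAlgebra (hs : ∀ a : A, ‖star a‖ = ‖a‖)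
    (hc : ∀ a : A, ‖star a * a‖ = ‖a‖ ^ 2) : CStarAlgebra (Completion A) :=
  have hst : UniformContinuous (star : A → A) :=
    (AddMonoidHomClass.isometry_of_norm (starAddEquiv : A ≃+ A) hs).uniformContinuous
  have hcoe : ∀ a : A, Completion.map star (a : Completion A) = (star a : A) :=
    fun a => Completion.map_coe hst a
  have hcont : Continuous (Completion.map (star : A → A)) := Completion.continuous_map
  letI : StarRing (Completion A) :=
    { star := Completion.map star
      star_involutive := fun x => by
        induction x using Completion.induction_on with
        | hp => exact isClosed_eq (hcont.comp hcont) continuous_id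
        | ih a => rw [hcoe, hcoe, star_star]
      star_mul := fun x y => by
        induction x, y using Completion.induction_on₂ with
        | hp => exact isClosed_eq (hcont.comp (by fun_prop))
                  ((hcont.comp continuous_snd).mul (hcont.comp continuous_fst))
        | ih a b => rw [← Completion.coe_mul, hcoe, hcoe, hcoe, star_mul, Completion.coe_mul]
      star_add := fun x y => by
        induction x, y using Completion.induction_on₂ with
        | hp => exact isClosed_eq (hcont.comp (by fun_prop))
                  ((hcont.comp continuous_fst).add (hcont.comp continuous_snd))
        | ih a b => rw [← Completion.coe_add, hcoe, hcoe, hcoe, star_add, Completion.coe_add] }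
  { norm_mul_self_le := fun x => by
      change ‖x‖ * ‖x‖ ≤ ‖Completion.map star x * x‖
      induction x using Completion.induction_on with
      | hp => exact isClosed_le (by fun_prop) ((hcont.mul continuous_id).norm)
      | ih a =>
        rw [hcoe, ← Completion.coe_mul, Completion.norm_coe, Completion.norm_coe, hc, sq]
    norm_smul_le := norm_smul_le
    star_smul := fun c x => by
      change Completion.map star (c • x) = star c • Completion.map star x
      induction x using Completion.induction_on with
      | hp => exact isClosed_eq (hcont.comp (continuous_const_smul c)) (continuous_const_smul (star c) |>.comp hcont)
      | ih a => rw [← Completion.coe_smul, hcoe, hcoe, star_smul, Completion.coe_smul] }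

theorem exists_starAlgHom_completion (hs : ∀ a : A, ‖star a‖ = ‖a‖)
    (hc : ∀ a : A, ‖star a * a‖ = ‖a‖ ^ 2) :
    ∃ (D : Type u) (_ : CStarAlgebra D) (f : A →⋆ₐ[ℂ] D), ∀ a, ‖f a‖ = ‖a‖ := by
  let := completionCStarAlgebra hs hc
  refine ⟨Completion A, completionCStarAlgebra hs hc,
    { toFun := fun a => (a : Completion A)
      map_one' := Completion.coe_one A
      map_mul' := fun a b => Completion.coe_mul a b
      map_zero' := Completion.coe_zero
      map_add' := fun a b => Completion.coe_add a b
      commutes' := fun r => rfl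
      map_star' := fun a => ?_ }, fun a => Completion.norm_coe a⟩
  exact (Completion.map_coe
    (AddMonoidHomClass.isometry_of_norm (starAddEquiv : A ≃+ A) hs).uniformContinuous a).symm

end Completion

section Seminorm

/-- The C*-identity and submultiplicativity give `q b ^ 2 ≤ q (star b) * q b`. Cancel `q b`, then
exchange `b` and `star b`. -/
theorem star_eq_of_cstarSeminorm {A : Type u} [Ring A] [StarRing A] [Algebra ℂ A]
    {q : Seminorm ℂ A} (hm : ∀ a b, q (a * b) ≤ q a * q b)
    (hc : ∀ a, q (star a * a) = q a ^ 2) (a : A) : q (star a) = q a := by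
  have key : ∀ b, q b ≤ q (star b) := fun b => by
    rcases (apply_nonneg q b).eq_or_lt with h | h
    · rw [← h]; exact apply_nonneg q _
    · have := hm (star b) b
      rw [hc, sq] at this
      exact le_of_mul_le_mul_right this h
  exact le_antisymm (by simpa using key (star a)) (key a)

variable {A : Type u} [Ring A] [StarRing A] [Algebra ℂ A] [StarModule ℂ A]

/-- Every C*-seminorm is the pullback of a C*-norm. -/
theorem exists_starAlgHom_of_cstarSeminorm (q : Seminorm ℂ A)
    (hm : ∀ a b, q (a * b) ≤ q a * q b) (hc : ∀ a, q (star a * a) = q a ^ 2) :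
    ∃ (D : Type u) (_ : CStarAlgebra D) (f : A →⋆ₐ[ℂ] D), ∀ a, ‖f a‖ = q a := by
  let : SeminormedRing A :=
    { ‹Ring A›, q.toAddGroupSeminorm.toSeminormedAddCommGroup with
      norm_mul_le := hm }
  let : NormedAlgebra ℂ A := { norm_smul_le := fun c a => (map_smul_eq_mul q c a).le }
  exact exists_starAlgHom_completion (star_eq_of_cstarSeminorm hm hc) hc

end Seminorm

/-! ### Square roots as limits of polynomials. -/

section SquareRoot

open Filter Topology

/-- Real polynomials converging to the square root, uniformly on bounded intervals. -/
theorem exists_polynomial_tendsto_sqrt : ∃ q : ℕ → Polynomial ℝ, ∀ k : ℕ,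
    ∀ x ∈ Set.Icc (-(k : ℝ)) k, |(q k).eval x - √x| < 1 / ((k : ℝ) + 1) := by
  -- The intervals grow while the error shrinks, so one sequence serves every spectrum and hence all
  -- seminorms at once.
  choose q hq using fun k : ℕ => exists_polynomial_near_of_continuousOn (-(k : ℝ)) k Real.sqrt
    Real.continuous_sqrt.continuousOn (1 / ((k : ℝ) + 1)) (by positivity)
  exact ⟨q, hq⟩

/-- The square root of the positive part of a self-adjoint element. -/
noncomputable def posSqrt {B : Type*} [CStarAlgebra B] (b : B) : B := cfc Real.sqrt b

theorem isSelfAdjoint_posSqrt {B : Type*} [CStarAlgebra B] (b : B) :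
    IsSelfAdjoint (posSqrt b) := cfc_predicate _ _

theorem posSqrt_mul_self {B : Type*} [CStarAlgebra B] [PartialOrder B] [StarOrderedRing B] {b : B}
    (hb : 0 ≤ b) : posSqrt b * posSqrt b = b := by
  rw [posSqrt, ← cfc_mul Real.sqrt Real.sqrt b]
  conv_rhs => rw [← cfc_id ℝ b]
  exact cfc_congr fun x hx => Real.mul_self_sqrt (spectrum_nonneg_of_nonneg hb hx)

theorem tendsto_aeval_posSqrt {B : Type*} [CStarAlgebra B] {q : ℕ → Polynomial ℝ}
    (hq : ∀ k : ℕ, ∀ x ∈ Set.Icc (-(k : ℝ)) k, |(q k).eval x - √x| < 1 / ((k : ℝ) + 1))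
    {b : B} (hb : IsSelfAdjoint b) :
    Tendsto (fun k => Polynomial.aeval b ((q k).map (algebraMap ℝ ℂ))) atTop
      (𝓝 (posSqrt b)) := by
  simp only [Polynomial.aeval_map_algebraMap, posSqrt]
  rw [tendsto_iff_norm_sub_tendsto_zero]
  refine squeeze_zero' (Eventually.of_forall fun _ => norm_nonneg _) ?_
    tendsto_one_div_add_atTop_nhds_zero_nat
  obtain ⟨N, hN⟩ := exists_nat_ge (‖b‖ * ‖(1 : B)‖)
  filter_upwards [eventually_ge_atTop N] with k hk
  rw [← cfc_polynomial (q k) b hb, ← cfc_sub (fun x => (q k).eval x) Real.sqrt b]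
  refine norm_cfc_le (by positivity) fun x hx => (hq k x ?_).le
  have h1 : ‖x‖ ≤ ‖b‖ * ‖(1 : B)‖ := spectrum.norm_le_norm_mul_of_mem hx
  have h2 : (N : ℝ) ≤ k := by exact_mod_cast hk
  rw [Real.norm_eq_abs] at h1
  exact abs_le.mp (h1.trans (hN.trans h2))

/-- The seminorms generate the uniformity, so being Cauchy for each of them is enough. Completeness
of `A` enters the proof here. -/
theorem exists_tendsto_of_seminorm_cauchy {A : Type u} {Λ : Type v} [AddCommGroup A] [Module ℂ A]
    [UniformSpace A] [IsUniformAddGroup A] [CompleteSpace A] {p : Λ → Seminorm ℂ A}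
    (hp : WithSeminorms p) {x : ℕ → A}
    (hx : ∀ l, Tendsto (fun k : ℕ × ℕ => p l (x k.2 - x k.1)) atTop (𝓝 0)) :
    ∃ y, ∀ l, Tendsto (fun k => p l (x k - y)) atTop (𝓝 0) := by
  have hc : CauchySeq x := by
    rw [cauchySeq_iff_tendsto, uniformity_eq_comap_nhds_zero, tendsto_comap_iff,
      hp.tendsto_nhds]
    intro l ε hε
    simpa using (hx l).eventually (gt_mem_nhds hε)
  obtain ⟨y, hy⟩ := cauchySeq_tendsto_of_complete hc
  refine ⟨y, fun l => ?_⟩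
  rw [Metric.tendsto_nhds]
  intro ε hε
  filter_upwards [(hp.tendsto_nhds x y).1 hy l ε hε] with k hk
  simpa [abs_of_nonneg] using hk

end SquareRoot

/-! ### Positive matrices over `A` and over its C*-completions. -/

section MatrixHom

variable {A : Type*} [Ring A] [StarRing A] [Algebra ℂ A] {D : Type*} [CStarAlgebra D]

/-- The entrywise application of a *-homomorphism to matrices. -/
noncomputable def matrixHom (f : A →⋆ₐ[ℂ] D) (n : ℕ) :
    Matrix (Fin n) (Fin n) A →⋆ₐ[ℂ] CStarMatrix (Fin n) (Fin n) D where
  toFun M := CStarMatrix.ofMatrix (M.map f)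
  map_one' := by
    ext i j
    simp [CStarMatrix.one_apply, Matrix.one_apply]
  map_mul' M N := by
    ext i j
    simp [CStarMatrix.mul_apply, Matrix.mul_apply]
  map_zero' := by ext i j; simp
  map_add' M N := by ext i j; simp
  commutes' r := by
    ext i j
    simp only [CStarMatrix.ofMatrix_apply, Matrix.map_apply, Matrix.algebraMap_matrix_apply,
      CStarMatrix.algebraMap_apply]
    split_ifs <;> simp [AlgHomClass.commutes]
  map_star' M := by
    ext i j
    simp [CStarMatrix.star_apply, Matrix.star_apply, map_star]

@[simp]
theorem matrixHom_apply (f : A →⋆ₐ[ℂ] D) {n : ℕ} (M : Matrix (Fin n) (Fin n) A) (i j : Fin n) :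
    matrixHom f n M i j = f (M i j) := rfl

end MatrixHom

section Positivity

open Filter Topology

variable {A : Type u} [Ring A] [StarRing A] [Algebra ℂ A] [StarModule ℂ A]
  [UniformSpace A] [IsUniformAddGroup A] {Λ : Type v} [PartialOrder Λ] {p : Λ → Seminorm ℂ A}

/-- A self-adjoint matrix over a locally C*-algebra has a square root of its positive part. -/
theorem IsLocallyCStarAlgebra.exists_matrix_sqrt (hA : IsLocallyCStarAlgebra p) {n : ℕ}
    {N : Matrix (Fin n) (Fin n) A} (hN : IsSelfAdjoint N) :
    ∃ R : Matrix (Fin n) (Fin n) A, ∀ (l : Λ) (D : Type u) [CStarAlgebra D] [PartialOrder D]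
      [StarOrderedRing D] (f : A →⋆ₐ[ℂ] D), (∀ a, ‖f a‖ = p l a) →
      matrixHom f n R = posSqrt (matrixHom f n N) := by
  obtain ⟨q, hq⟩ := exists_polynomial_tendsto_sqrt
  have hcomp := hA.complete
  -- The polynomials are evaluated over `A` itself, so the limit does not depend on the seminorm.
  set x : ℕ → Matrix (Fin n) (Fin n) A := fun k => Polynomial.aeval N ((q k).map (algebraMap ℝ ℂ)) with hx
  have hlim : ∀ (l : Λ) (D : Type u) [CStarAlgebra D] [PartialOrder D]
      [StarOrderedRing D] (f : A →⋆ₐ[ℂ] D) (i j : Fin n),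
      Tendsto (fun k => f (x k i j)) atTop (𝓝 (posSqrt (matrixHom f n N) i j)) := by
    intro l D _ _ _ f i j
    have h1 := tendsto_aeval_posSqrt hq (hN.map (matrixHom f n))
    have h2 : ∀ k, Polynomial.aeval (matrixHom f n N) ((q k).map (algebraMap ℝ ℂ)) =
        matrixHom f n (x k) := fun k =>
      Polynomial.aeval_algHom_apply (matrixHom f n).toAlgHom N _
    simp only [h2] at h1
    exact ((continuous_apply j).comp (continuous_apply i)).continuousAt.tendsto.comp h1
  have hentry : ∀ i j, ∃ y, ∀ l, Tendsto (fun k => p l (x k i j - y)) atTop (𝓝 0) := by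
    refine fun i j => exists_tendsto_of_seminorm_cauchy hA.withSeminorms fun l => ?_
    obtain ⟨D, _, f, hf⟩ := exists_starAlgHom_of_cstarSeminorm (p l) (hA.mul_le l)
      (hA.star_mul_self l)
    let := CStarAlgebra.spectralOrder D
    have := CStarAlgebra.spectralOrderedRing D
    have h := hlim l D f i j
    rw [← prod_atTop_atTop_eq]
    have h' := ((h.comp tendsto_snd).sub (h.comp (tendsto_fst (f := atTop) (g := atTop)))).norm
    simpa [← map_sub, hf] using h'
  choose R hR using hentry
  refine ⟨Matrix.of R, fun l D _ _ _ f hf => ?_⟩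
  ext i j
  refine tendsto_nhds_unique ?_ (hlim l D f i j)
  rw [tendsto_iff_norm_sub_tendsto_zero]
  simpa [← map_sub, hf] using hR i j l

/-- The point is to lift a factorisation to `A`, although `f` need not be onto. The square root of
the image is a limit of polynomials, so it comes from a matrix over `A`. -/
theorem IsLocallyCStarAlgebra.matrixLocallyNonneg_iff (hA : IsLocallyCStarAlgebra p) {l : Λ}
    {D : Type u} [CStarAlgebra D] [PartialOrder D] [StarOrderedRing D] {f : A →⋆ₐ[ℂ] D}
    (hf : ∀ a, ‖f a‖ = p l a) {n : ℕ} {M : Matrix (Fin n) (Fin n) A} :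
    MatrixLocallyNonneg p l M ↔ 0 ≤ matrixHom f n M := by
  have hz : ∀ C : Matrix (Fin n) (Fin n) A, MatrixLocallyZero p l C ↔ matrixHom f n C = 0 := by
    intro C
    simp [MatrixLocallyZero, ← CStarMatrix.ext_iff, ← hf]
  constructor
  · rintro ⟨B, C, rfl, hC⟩
    rw [map_add, (hz C).1 hC, add_zero, map_mul, ← Matrix.star_eq_conjTranspose, map_star]
    exact star_mul_self_nonneg _
  · intro h
    -- Only the image of `M` is known to be self-adjoint; the real part of `M` has the same image.
    set N : Matrix (Fin n) (Fin n) A := (1 / 2 : ℂ) • (M + star M) with hNdef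
    have hN : IsSelfAdjoint N := by
      rw [IsSelfAdjoint, hNdef, star_smul, star_add, star_star, add_comm]
      simp
    have hNM : matrixHom f n N = matrixHom f n M := by
      have : star (matrixHom f n M) = matrixHom f n M := (IsSelfAdjoint.of_nonneg h).star_eq
      rw [hNdef, map_smul, map_add, map_star, this, ← two_smul ℂ, smul_smul]
      norm_num
    obtain ⟨R, hR⟩ := hA.exists_matrix_sqrt hN
    refine ⟨R, M - Rᴴ * R, by simp, (hz _).2 ?_⟩
    have hs := hR l D f hf
    rw [hNM] at hs
    rw [map_sub, map_mul, ← Matrix.star_eq_conjTranspose, map_star, hs,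
      (isSelfAdjoint_posSqrt _).star_eq, posSqrt_mul_self h, sub_self]

end Positivity

/-! ### The cone of locally positive matrices. -/

section Cone

variable {A : Type u} [Ring A] [StarRing A] [Algebra ℂ A]
  {Λ : Type v} {p : Λ → Seminorm ℂ A} {l : Λ} {n : ℕ}

theorem MatrixLocallyNonneg.add_locallyZero {M C : Matrix (Fin n) (Fin n) A}
    (hM : MatrixLocallyNonneg p l M) (hC : MatrixLocallyZero p l C) :
    MatrixLocallyNonneg p l (M + C) := by
  obtain ⟨B, C', rfl, hC'⟩ := hM
  refine ⟨B, C' + C, by rw [add_assoc], fun i j => ?_⟩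
  exact le_antisymm ((map_add_le_add _ _ _).trans (by rw [hC' i j, hC i j, add_zero]))
    (apply_nonneg _ _)

theorem MatrixLocallyZero.nonneg {C : Matrix (Fin n) (Fin n) A}
    (hC : MatrixLocallyZero p l C) : MatrixLocallyNonneg p l C :=
  ⟨0, C, by simp, hC⟩

/-- The factor `B` has first row `b` and zeros elsewhere, which is why size zero is separate. -/
theorem matrixLocallyNonneg_star_mul (b : Fin n → A) :
    MatrixLocallyNonneg p l (Matrix.of fun i j => star (b i) * b j) := by
  cases n with
  | zero => exact ⟨0, 0, Subsingleton.elim _ _, fun i => i.elim0⟩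
  | succ n =>
    refine ⟨Matrix.of fun i j => if i = 0 then b j else 0, 0, ?_, fun i j => by simp⟩
    ext i j
    simp only [Matrix.of_apply, add_zero, Matrix.mul_apply, Matrix.conjTranspose_apply]
    rw [Finset.sum_eq_single 0] <;> simp +contextual

variable [StarModule ℂ A]

theorem MatrixLocallyNonneg.smul {M : Matrix (Fin n) (Fin n) A}
    (hM : MatrixLocallyNonneg p l M) {r : ℝ} (hr : 0 ≤ r) :
    MatrixLocallyNonneg p l ((r : ℂ) • M) := by
  obtain ⟨B, C, rfl, hC⟩ := hM
  refine ⟨((√r : ℝ) : ℂ) • B, (r : ℂ) • C, ?_, fun i j => ?_⟩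
  · rw [smul_add, Matrix.conjTranspose_smul, Matrix.smul_mul, Matrix.mul_smul, smul_smul]
    congr 2
    simp [← Complex.ofReal_mul, Real.mul_self_sqrt hr]
  · rw [Matrix.smul_apply, map_smul_eq_mul, hC i j, mul_zero]

variable [UniformSpace A] [IsUniformAddGroup A] [PartialOrder Λ]

namespace IsLocallyCStarAlgebra

theorem exists_faithful (hA : IsLocallyCStarAlgebra p) (l : Λ) :
    ∃ (D : Type u) (_ : CStarAlgebra D) (_ : PartialOrder D) (_ : StarOrderedRing D)
      (f : A →⋆ₐ[ℂ] D), ∀ a, ‖f a‖ = p l a := by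
  obtain ⟨D, i, f, hf⟩ := exists_starAlgHom_of_cstarSeminorm (p l) (hA.mul_le l)
    (hA.star_mul_self l)
  exact ⟨D, i, CStarAlgebra.spectralOrder D, CStarAlgebra.spectralOrderedRing D, f, hf⟩

/-- A sum of two squares must again be a square modulo `ker p_l`; this is read off in the C*-algebra
that carries `p l`. -/
theorem nonneg_add (hA : IsLocallyCStarAlgebra p) {M N : Matrix (Fin n) (Fin n) A}
    (hM : MatrixLocallyNonneg p l M) (hN : MatrixLocallyNonneg p l N) :
    MatrixLocallyNonneg p l (M + N) := by
  obtain ⟨D, _, _, _, f, hf⟩ := hA.exists_faithful l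
  rw [hA.matrixLocallyNonneg_iff hf] at *
  rw [map_add]
  exact add_nonneg hM hN

theorem nonneg_sum (hA : IsLocallyCStarAlgebra p) {ι : Type*} (s : Finset ι)
    {M : ι → Matrix (Fin n) (Fin n) A} (hM : ∀ i ∈ s, MatrixLocallyNonneg p l (M i)) :
    MatrixLocallyNonneg p l (∑ i ∈ s, M i) :=
  Finset.sum_induction M (MatrixLocallyNonneg p l) (fun _ _ => hA.nonneg_add)
    (MatrixLocallyZero.nonneg fun i j => by simp) hM

/-- Compression of a positive matrix by a rectangular scalar matrix. -/
theorem nonneg_compress (hA : IsLocallyCStarAlgebra p) {m : ℕ} {M : Matrix (Fin n) (Fin n) A}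
    (hM : MatrixLocallyNonneg p l M) (W : Fin n → Fin m → ℂ) :
    MatrixLocallyNonneg p l
      (Matrix.of fun i j => ∑ k, ∑ k', (star (W k i) * W k' j) • M k k') := by
  obtain ⟨B, C, rfl, hC⟩ := hM
  -- Modulo `ker p_l` the compressed matrix is `(BW)⋆(BW)`. As `BW` is rectangular, it is treated
  -- row by row.
  have h1 := hA.nonneg_sum Finset.univ (l := l) (M := fun r => Matrix.of fun i j =>
    star (∑ k, W k i • B r k) * ∑ k', W k' j • B r k')
    fun r _ => matrixLocallyNonneg_star_mul fun i => ∑ k, W k i • B r k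
  have h2 : MatrixLocallyZero p l (Matrix.of fun (i j : Fin m) =>
      ∑ k, ∑ k', (star (W k i) * W k' j) • C k k') := by
    intro i j
    have : ∀ s : Finset (Fin n), ∀ g : Fin n → A, (∀ k, p l (g k) = 0) →
        p l (∑ k ∈ s, g k) = 0 := fun s g hg =>
      Finset.sum_induction g (fun a => p l a = 0)
        (fun a b ha hb => le_antisymm ((map_add_le_add _ _ _).trans (by rw [ha, hb, add_zero]))
          (apply_nonneg _ _)) (map_zero _) fun k _ => hg k
    rw [Matrix.of_apply]
    exact this _ _ fun k => this _ _ fun k' => by rw [map_smul_eq_mul, hC, mul_zero]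
  convert h1.add_locallyZero h2 using 1
  ext i j
  simp only [Matrix.of_apply, Matrix.add_apply, Matrix.sum_apply, Matrix.mul_apply,
    Matrix.conjTranspose_apply, smul_add, Finset.sum_add_distrib, star_sum, star_smul,
    Finset.sum_mul_sum, Finset.smul_sum, smul_mul_smul_comm]
  congr 1
  conv_rhs => rw [Finset.sum_comm]
  refine Finset.sum_congr rfl fun k _ => ?_
  rw [Finset.sum_comm]

/-- A self-adjoint matrix becomes positive after adding a large multiple of the identity. -/
theorem exists_nonneg_add_smul_one (hA : IsLocallyCStarAlgebra p) (l : Λ)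
    {M : Matrix (Fin n) (Fin n) A} (hM : IsSelfAdjoint M) :
    ∃ R : ℝ, 0 ≤ R ∧ MatrixLocallyNonneg p l (M + (R : ℂ) • 1) := by
  obtain ⟨D, _, _, _, f, hf⟩ := hA.exists_faithful l
  have key : ∀ {B : Type u} [CStarAlgebra B] [PartialOrder B] [StarOrderedRing B] {b : B},
      IsSelfAdjoint b → 0 ≤ b + (‖b‖ : ℂ) • (1 : B) := by
    intro B _ _ _ b hb
    have := hb.neg_algebraMap_norm_le_self
    rw [Algebra.algebraMap_eq_smul_one, ← Complex.coe_smul] at this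
    exact neg_le_iff_add_nonneg.1 this
  refine ⟨‖matrixHom f n M‖, norm_nonneg _, (hA.matrixLocallyNonneg_iff hf).2 ?_⟩
  rw [map_add, map_smul, map_one]
  exact key (hM.map _)

/-- This is `a⋆a ≤ ‖a‖²` in the C*-algebra, with a factor of the gap lifted to `A` through matrices
of size 1. -/
theorem exists_sub_star_mul_self (hA : IsLocallyCStarAlgebra p) (l : Λ) (a : A) :
    ∃ g : A, p l ((p l a ^ 2 : ℂ) • 1 - star a * a - star g * g) = 0 := by
  obtain ⟨D, _, _, _, f, hf⟩ := hA.exists_faithful l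
  have h : 0 ≤ (p l a ^ 2 : ℂ) • 1 - star (f a) * f a := by
    have := CStarAlgebra.star_mul_le_algebraMap_norm_sq (a := f a)
    rw [Algebra.algebraMap_eq_smul_one, ← Complex.coe_smul, hf] at this
    rw [sub_nonneg]
    exact_mod_cast this
  obtain ⟨y, hy⟩ := CStarAlgebra.nonneg_iff_eq_star_mul_self.1 h
  have hM : MatrixLocallyNonneg p l (n := 1)
      (Matrix.of fun _ _ => (p l a ^ 2 : ℂ) • 1 - star a * a) := by
    rw [hA.matrixLocallyNonneg_iff hf]
    convert star_mul_self_nonneg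
      (CStarMatrix.ofMatrix (Matrix.of fun _ _ => y) : CStarMatrix (Fin 1) (Fin 1) D) using 1
    ext i j
    simp [CStarMatrix.mul_apply, CStarMatrix.star_apply, map_star, hy]
  obtain ⟨B, C, hBC, hC⟩ := hM
  refine ⟨B 0 0, ?_⟩
  have := congrFun (congrFun hBC 0) 0
  simp only [Matrix.of_apply, Matrix.add_apply, Matrix.mul_apply, Finset.univ_unique,
    Fin.default_eq_zero, Matrix.conjTranspose_apply, Finset.sum_singleton] at this
  rw [this, add_sub_cancel_left]
  exact hC 0 0

end IsLocallyCStarAlgebra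

end Cone

/-! ### Stinespring's construction. -/

section AbstractDilation

open UniformSpace

/-- A *-representation by linear maps on a pre-Hilbert space, bounded by a seminorm, extends to
the completion. -/
theorem exists_rep_completion {A : Type u} [Ring A] [StarRing A] [Algebra ℂ A]
    {E : Type w} [SeminormedAddCommGroup E] [InnerProductSpace ℂ E] (L : A → E →ₗ[ℂ] E)
    (q : A → ℝ) (hq : ∀ a, 0 ≤ q a) (hL : ∀ a x, ‖L a x‖ ≤ q a * ‖x‖)
    (hone : ∀ x, L 1 x = x) (hmul : ∀ a b x, L (a * b) x = L a (L b x))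
    (hadd : ∀ a b x y, inner ℂ y (L (a + b) x) = inner ℂ y (L a x) + inner ℂ y (L b x))
    (hsmul : ∀ (c : ℂ) a x y, inner ℂ y (L (c • a) x) = c * inner ℂ y (L a x))
    (hstar : ∀ a x y, inner ℂ (L (star a) x) y = inner ℂ x (L a y)) :
    ∃ (K : Type w) (_ : NormedAddCommGroup K) (_ : InnerProductSpace ℂ K) (_ : CompleteSpace K)
      (ι : E →ₗ[ℂ] K) (ρ : A →⋆ₐ[ℂ] (K →L[ℂ] K)),
      DenseRange ι ∧ (∀ x y, inner ℂ (ι x) (ι y) = inner ℂ x y) ∧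
      (∀ a x, ρ a (ι x) = ι (L a x)) ∧ ∀ a, ‖ρ a‖ ≤ q a := by
  set T : A → Completion E →L[ℂ] Completion E :=
    fun a => ((L a).mkContinuous (q a) (hL a)).completion with hT
  have hTc : ∀ a (x : E), T a x = (L a x : E) := fun a x => by simp [hT]
  have hext : ∀ {S S' : Completion E →L[ℂ] Completion E}, (∀ x y : E,
      inner ℂ (y : Completion E) (S x) = inner ℂ (y : Completion E) (S' x)) → S = S' := by
    intro S S' h
    ext x
    refine ext_inner_left ℂ fun y => ?_
    induction x, y using Completion.induction_on₂ with
    | hp => apply isClosed_eq <;> fun_prop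
    | ih x y => exact h x y
  have hTone : T 1 = 1 := hext fun x y => by rw [hTc, hone]; rfl
  have hTsmul : ∀ (c : ℂ) a, T (c • a) = c • T a := fun c a => hext fun x y => by
    simp only [hTc, _root_.smul_apply, inner_smul_right, Completion.inner_coe, hsmul]
  have hTadd : ∀ a b, T (a + b) = T a + T b := fun a b => hext fun x y => by
    simp only [hTc, _root_.add_apply, inner_add_right, Completion.inner_coe, hadd]
  refine ⟨Completion E, inferInstance, inferInstance, inferInstance,
    (Completion.toComplL : E →L[ℂ] Completion E).toLinearMap,
    { toFun := T
      map_one' := hTone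
      map_mul' := fun a b => hext fun x y => by
        simp only [hTc, mul_apply_eq_comp, hmul]
      map_zero' := by simpa using hTsmul 0 0
      map_add' := hTadd
      commutes' := fun c => by
        rw [Algebra.algebraMap_eq_smul_one, Algebra.algebraMap_eq_smul_one, hTsmul, hTone]
      map_star' := fun a => ?_ }, ?_, ?_, ?_, ?_⟩
  · rw [ContinuousLinearMap.star_eq_adjoint]
    refine (ContinuousLinearMap.eq_adjoint_iff _ _).2 fun x y => ?_
    induction x, y using Completion.induction_on₂ with
    | hp => apply isClosed_eq <;> fun_prop
    | ih x y => simp only [hTc, Completion.inner_coe, hstar]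
  · exact Completion.denseRange_coe
  · exact fun x y => Completion.inner_coe x y
  · exact fun a x => hTc a x
  · intro a
    refine ContinuousLinearMap.opNorm_le_bound _ (hq a) fun x => ?_
    change ‖T a x‖ ≤ q a * ‖x‖
    induction x using Completion.induction_on with
    | hp => apply isClosed_le <;> fun_prop
    | ih x => simpa only [hTc, Completion.norm_coe] using hL a x

end AbstractDilation

section LeftMul

variable {A : Type u} [Ring A] {H : Type w} [AddCommGroup H] [Module ℂ H]

/-- Left multiplication by `a` on finitely supported functions. -/
noncomputable def leftMul (H : Type w) [AddCommGroup H] [Module ℂ H] (a : A) :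
    (A →₀ H) →ₗ[ℂ] (A →₀ H) :=
  Finsupp.lmapDomain H ℂ (fun b => a * b)

theorem leftMul_single (a b : A) (ξ : H) :
    leftMul H a (Finsupp.single b ξ) = Finsupp.single (a * b) ξ := by
  simp [leftMul, Finsupp.mapDomain_single]

theorem leftMul_one (x : A →₀ H) : leftMul H (1 : A) x = x := by
  simp only [leftMul, Finsupp.lmapDomain_apply, one_mul]
  exact Finsupp.mapDomain_id

theorem leftMul_mul (a b : A) (x : A →₀ H) :
    leftMul H (a * b) x = leftMul H a (leftMul H b x) := by
  simp only [leftMul, Finsupp.lmapDomain_apply, ← Finsupp.mapDomain_comp]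
  congr 1
  ext c
  simp [mul_assoc]

end LeftMul

section PositiveForm

variable {A : Type u} [Ring A] [StarRing A] [Algebra ℂ A] {Λ : Type v}
  {H : Type w} [AddCommGroup H] [Module ℂ H]

/-- A form `F a η ξ = ⟪η, Φ(a) ξ⟫` associated with a map `Φ`, completely positive with respect to
`≥_l`, into the sesquilinear forms on `H`. -/
structure IsPositiveForm (p : Λ → Seminorm ℂ A) (l : Λ) (F : A → H → H → ℂ) : Prop where
  map_add : ∀ a b η ξ, F (a + b) η ξ = F a η ξ + F b η ξ
  map_smul : ∀ (c : ℂ) a η ξ, F (c • a) η ξ = c * F a η ξ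
  add_right : ∀ a η ξ ξ', F a η (ξ + ξ') = F a η ξ + F a η ξ'
  smul_right : ∀ (c : ℂ) a η ξ, F a η (c • ξ) = c * F a η ξ
  symm : ∀ a η ξ, star (F a η ξ) = F (star a) ξ η
  nonneg : ∀ (n : ℕ) (M : Matrix (Fin n) (Fin n) A), MatrixLocallyNonneg p l M →
    ∀ ξ : Fin n → H, 0 ≤ ∑ i, ∑ j, F (M i j) (ξ i) (ξ j)

namespace IsPositiveForm

variable {p : Λ → Seminorm ℂ A} {l : Λ} {F : A → H → H → ℂ}

theorem add_left (hF : IsPositiveForm p l F) (a : A) (η η' ξ : H) :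
    F a (η + η') ξ = F a η ξ + F a η' ξ := by
  have h := fun η => hF.symm (star a) ξ η
  simp only [star_star] at h
  rw [← h, ← h, ← h, hF.add_right, star_add]

theorem smul_left (hF : IsPositiveForm p l F) (c : ℂ) (a : A) (η ξ : H) :
    F a (c • η) ξ = star c * F a η ξ := by
  have h := fun η => hF.symm (star a) ξ η
  simp only [star_star] at h
  rw [← h, ← h, hF.smul_right, star_mul']

theorem map_zero_left (hF : IsPositiveForm p l F) (a : A) (ξ : H) : F a 0 ξ = 0 := by
  simpa using hF.smul_left 0 a 0 ξ

theorem map_zero_right (hF : IsPositiveForm p l F) (a : A) (η : H) : F a η 0 = 0 := by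
  simpa using hF.smul_right 0 a η 0

/-- The form `∑ a, ∑ b, F (a⋆ b) (x a) (y b)` on finitely supported functions. -/
noncomputable def gram (F : A → H → H → ℂ) (x y : A →₀ H) : ℂ :=
  x.sum fun a η => y.sum fun b ξ => F (star a * b) η ξ

theorem gram_single_single (hF : IsPositiveForm p l F) (a b : A) (η ξ : H) :
    gram F (Finsupp.single a η) (Finsupp.single b ξ) = F (star a * b) η ξ := by
  rw [gram, Finsupp.sum_single_index, Finsupp.sum_single_index]
  · exact hF.map_zero_right _ _
  · rw [Finsupp.sum_single_index] <;> exact hF.map_zero_left _ _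

theorem gram_add_left (hF : IsPositiveForm p l F) (x y z : A →₀ H) :
    gram F (x + y) z = gram F x z + gram F y z :=
  Finsupp.sum_add_index' (fun a => by simp [hF.map_zero_left])
    fun a η η' => by simp only [hF.add_left, Finsupp.sum_add]

theorem gram_symm (hF : IsPositiveForm p l F) (x y : A →₀ H) :
    star (gram F y x) = gram F x y := by
  simp only [gram, Finsupp.sum, star_sum, hF.symm, star_mul, star_star]
  exact Finset.sum_comm

theorem gram_smul_left (hF : IsPositiveForm p l F) (x y : A →₀ H) (c : ℂ) :
    gram F (c • x) y = star c * gram F x y := by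
  rw [gram, Finsupp.sum_smul_index' (fun a => by simp [hF.map_zero_left])]
  simp only [hF.smul_left, gram, Finsupp.sum, Finset.mul_sum]

/-- Complete positivity for the row `g * a`, the terms in `c` being invisible to `p l`. Taking `g =
1`, `c = 0` gives positivity of the Gram form; `g` from `exists_sub_star_mul_self` gives boundedness
of left multiplication. -/
theorem sum_finset_nonneg (hF : IsPositiveForm p l F)
    (hp : ∀ a b, p l (a * b) ≤ p l a * p l b) {g c : A} (hc : p l c = 0) (s : Finset A)
    (ξ : A → H) :
    0 ≤ ∑ a ∈ s, ∑ b ∈ s, F (star a * ((star g * g + c) * b)) (ξ a) (ξ b) := by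
  set e := s.equivFin.symm
  have h0 : ∀ a b, p l (a * (c * b)) = 0 := fun a b =>
    le_antisymm ((hp _ _).trans (by
      have : p l (c * b) ≤ 0 := (hp _ _).trans (by simp [hc])
      rw [le_antisymm this (apply_nonneg _ _), mul_zero])) (apply_nonneg _ _)
  have key := hF.nonneg _ _ ((matrixLocallyNonneg_star_mul (p := p) (l := l)
    (fun i => g * (e i : A))).add_locallyZero (C := Matrix.of fun i j =>
      star (e i : A) * (c * (e j : A))) fun i j => h0 _ _) (fun i => ξ (e i))
  have conv : ∀ f : A → ℂ, ∑ a ∈ s, f a = ∑ i, f (e i) := fun f => by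
    rw [← Finset.sum_coe_sort s f, ← Equiv.sum_comp e]
  rw [conv]
  simp only [conv (fun b => F _ _ _)]
  refine key.trans_eq (Finset.sum_congr rfl fun i _ => Finset.sum_congr rfl fun j _ => ?_)
  simp only [Matrix.add_apply, Matrix.of_apply, star_mul]
  congr 1
  noncomm_ring

theorem gram_leftMul_right (hF : IsPositiveForm p l F) (a : A) (x y : A →₀ H) :
    gram F x (leftMul H a y) = x.sum fun b η => y.sum fun c ξ => F (star b * (a * c)) η ξ := by
  simp only [gram, leftMul, Finsupp.lmapDomain_apply]
  refine Finsupp.sum_congr fun b _ => ?_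
  exact Finsupp.sum_mapDomain_index (fun _ => hF.map_zero_right _ _)
    fun _ _ _ => hF.add_right _ _ _ _

theorem gram_leftMul_left (hF : IsPositiveForm p l F) (a : A) (x y : A →₀ H) :
    gram F (leftMul H (star a) x) y = gram F x (leftMul H a y) := by
  rw [← hF.gram_symm, hF.gram_leftMul_right, hF.gram_leftMul_right]
  simp only [Finsupp.sum, star_sum, hF.symm, star_mul, star_star, mul_assoc]
  exact Finset.sum_comm

theorem gram_self_nonneg (hp : ∀ a b, p l (a * b) ≤ p l a * p l b) (hF : IsPositiveForm p l F)
    (x : A →₀ H) : 0 ≤ gram F x x := by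
  simpa [gram, Finsupp.sum] using
    hF.sum_finset_nonneg hp (g := 1) (c := 0) (map_zero _) x.support x

variable [StarModule ℂ A] [UniformSpace A] [IsUniformAddGroup A] [PartialOrder Λ]

theorem gram_leftMul_self_le (hA : IsLocallyCStarAlgebra p) (hF : IsPositiveForm p l F)
    (a : A) (x : A →₀ H) :
    gram F (leftMul H a x) (leftMul H a x) ≤ (p l a ^ 2 : ℂ) * gram F x x := by
  obtain ⟨g, hg⟩ := hA.exists_sub_star_mul_self l a
  have key := hF.sum_finset_nonneg (hA.mul_le l) (g := g) hg x.support x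
  rw [← sub_nonneg]
  have h1 : gram F (leftMul H a x) (leftMul H a x) = gram F x (leftMul H (star a * a) x) := by
    rw [leftMul_mul, ← hF.gram_leftMul_left (star a), star_star]
  rw [h1, hF.gram_leftMul_right, gram]
  refine key.trans_eq ?_
  simp only [Finsupp.sum, Finset.mul_sum, ← Finset.sum_sub_distrib]
  refine Finset.sum_congr rfl fun b _ => Finset.sum_congr rfl fun c _ => ?_
  rw [← hF.map_smul, eq_sub_iff_add_eq, ← hF.map_add]
  congr 1
  simp only [add_sub_cancel, sub_mul, mul_sub, smul_mul_assoc, one_mul, mul_smul_comm]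
  abel

end IsPositiveForm

end PositiveForm

section Stinespring

open UniformSpace

variable {A : Type u} [Ring A] [StarRing A] [Algebra ℂ A] [StarModule ℂ A] [UniformSpace A]
  [IsUniformAddGroup A] {Λ : Type v} [PartialOrder Λ] {p : Λ → Seminorm ℂ A} {l : Λ}
  {H : Type w} [NormedAddCommGroup H] [InnerProductSpace ℂ H]

/-- Stinespring's dilation theorem. -/
theorem IsPositiveForm.exists_dilation (hA : IsLocallyCStarAlgebra p) {F : A → H → H → ℂ}
    (hF : IsPositiveForm p l F) (C : ℝ) (hC : ∀ ξ, (F 1 ξ ξ).re ≤ C * ‖ξ‖ ^ 2) :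
    ∃ (K : Type max u w) (_ : NormedAddCommGroup K) (_ : InnerProductSpace ℂ K)
      (_ : CompleteSpace K) (ρ : A →⋆ₐ[ℂ] (K →L[ℂ] K)) (V : H →L[ℂ] K),
      (∀ a, ‖ρ a‖ ≤ p l a) ∧ (∀ a η ξ, F a η ξ = inner ℂ (V η) (ρ a (V ξ))) ∧
      Dense (Submodule.span ℂ (Set.range fun x : A × H => ρ x.1 (V x.2)) : Set K) := by
  -- Finitely supported functions stand in for `A ⊗ H`: the missing bilinear relations are null
  -- vectors, killed by the completion.
  let core : PreInnerProductSpace.Core ℂ (A →₀ H) :=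
    { inner := gram F
      conj_inner_symm := fun x y => hF.gram_symm x y
      re_inner_nonneg := fun x => (Complex.le_def.1 (hF.gram_self_nonneg (hA.mul_le l) x)).1
      add_left := fun x y z => hF.gram_add_left x y z
      smul_left := fun x y c => hF.gram_smul_left x y c }
  let : SeminormedAddCommGroup (A →₀ H) :=
    InnerProductSpace.Core.toSeminormedAddCommGroup (c := core)
  let : InnerProductSpace ℂ (A →₀ H) := InnerProductSpace.ofCore core
  have hinner : ∀ x y : A →₀ H, inner ℂ x y = gram F x y := fun x y => rfl
  have hnorm : ∀ x : A →₀ H, ((‖x‖ : ℂ) ^ 2) = gram F x x := fun x => by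
    rw [← hinner, inner_self_eq_norm_sq_to_K]; rfl
  obtain ⟨K, _, _, _, ι, ρ, hι, hιi, hρ, hρn⟩ := exists_rep_completion (E := A →₀ H)
    (leftMul H) (p l) (fun a => apply_nonneg _ _)
    (fun a x => by
      rw [← sq_le_sq₀ (norm_nonneg _) (by positivity), mul_pow]
      have := hF.gram_leftMul_self_le hA a x
      rw [← hnorm, ← hnorm] at this
      exact_mod_cast this)
    leftMul_one leftMul_mul
    (fun a b x y => by
      simp only [hinner, hF.gram_leftMul_right, add_mul, mul_add, hF.map_add, Finsupp.sum_add])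
    (fun c a x y => by
      simp only [hinner, hF.gram_leftMul_right, smul_mul_assoc, mul_smul_comm, hF.map_smul,
        Finsupp.sum, Finset.mul_sum])
    (fun a x y => hF.gram_leftMul_left a x y)
  have hV : ∀ ξ : H, ‖ι (Finsupp.single 1 ξ)‖ ≤ √C * ‖ξ‖ := by
    intro ξ
    have h1 : ‖ι (Finsupp.single 1 ξ)‖ ^ 2 ≤ C * ‖ξ‖ ^ 2 := by
      refine le_trans (le_of_eq ?_) (hC ξ)
      rw [← inner_self_eq_norm_sq (𝕜 := ℂ), hιi, hinner, hF.gram_single_single]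
      simp
    rcases le_or_gt 0 C with h | h
    · rw [← sq_le_sq₀ (norm_nonneg _) (by positivity), mul_pow, Real.sq_sqrt h]
      exact h1
    · have : ‖ι (Finsupp.single 1 ξ)‖ ^ 2 ≤ 0 :=
        h1.trans (mul_nonpos_of_nonpos_of_nonneg h.le (sq_nonneg _))
      rw [pow_eq_zero_iff two_ne_zero |>.1 (le_antisymm this (sq_nonneg _))]
      positivity
  set V : H →L[ℂ] K := (ι ∘ₗ Finsupp.lsingle 1).mkContinuous (√C) hV
  have hV1 : ∀ ξ, V ξ = ι (Finsupp.single 1 ξ) := fun ξ => rfl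
  have hVa : ∀ a ξ, ρ a (V ξ) = ι (Finsupp.single a ξ) := fun a ξ => by
    rw [hV1, hρ, leftMul_single, mul_one]
  refine ⟨K, _, _, inferInstance, ρ, V, hρn, fun a η ξ => ?_, ?_⟩
  · rw [hVa, hV1, hιi, hinner, hF.gram_single_single]
    simp
  · refine Dense.mono ?_ hι
    rintro _ ⟨x, rfl⟩
    induction x using Finsupp.induction_linear with
    | zero => simp
    | add x y hx hy => rw [_root_.map_add]; exact add_mem hx hy
    | single a ξ => exact Submodule.subset_span ⟨(a, ξ), hVa a ξ⟩

/-- Operators are determined by their matrix coefficients in a generating set of vectors. -/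
theorem ext_of_dense_span {K : Type*} [NormedAddCommGroup K] [InnerProductSpace ℂ K] {s : Set K}
    (hs : Dense (Submodule.span ℂ s : Set K)) {T T' : K →L[ℂ] K}
    (h : ∀ x ∈ s, ∀ y ∈ s, inner ℂ x (T y) = inner ℂ x (T' y)) : T = T' := by
  refine ContinuousLinearMap.ext_on hs fun y hy => ?_
  refine hs.eq_of_inner_right ℂ fun x hx => ?_
  induction hx using Submodule.span_induction with
  | mem x hx => exact h x hx y hy
  | zero => simp
  | add x z _ _ hx hz => rw [inner_add_left, inner_add_left, hx, hz]
  | smul c x _ hx => rw [inner_smul_left, inner_smul_left, hx]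

end Stinespring

/-! ### Extension of positive functionals. -/

section RieszExtension

/-- The M. Riesz extension theorem for complex linear functionals. -/
theorem exists_complex_riesz_extension {E : Type*} [AddCommGroup E] [Module ℂ E] (P : Set E)
    (zero_mem : (0 : E) ∈ P) (add_mem : ∀ x ∈ P, ∀ y ∈ P, x + y ∈ P)
    (smul_mem : ∀ r : ℝ, 0 ≤ r → ∀ x ∈ P, (r : ℂ) • x ∈ P) (dom : Submodule ℂ E)
    (s : E →ₗ[ℂ] ℂ) (nonneg : ∀ x ∈ dom, x ∈ P → 0 ≤ (s x).re)
    (dense : ∀ y, ∃ x ∈ dom, x + y ∈ P) :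
    ∃ G : E →ₗ[ℂ] ℂ, (∀ x ∈ dom, G x = s x) ∧ ∀ x ∈ P, 0 ≤ (G x).re := by
  let C : PointedCone ℝ E :=
    { carrier := P
      zero_mem' := zero_mem
      add_mem' := fun hx hy => add_mem _ hx _ hy
      smul_mem' := fun r x hx => smul_mem r r.2 x hx }
  obtain ⟨g, hg, hgP⟩ := riesz_extension C
    ⟨dom.restrictScalars ℝ, (Complex.reLm ∘ₗ s.restrictScalars ℝ).domRestrict _⟩
    (fun x hx => nonneg x x.2 hx)
    (fun y => by
      obtain ⟨x, hx, hxy⟩ := dense y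
      exact ⟨⟨x, hx⟩, hxy⟩)
  have hg' : ∀ x ∈ dom, g x = (s x).re := fun x hx => hg ⟨x, hx⟩
  -- This is the complex functional with real part `g`; it agrees with `s` on `dom` because `dom` is
  -- stable under `I`.
  refine ⟨Module.Dual.extendRCLike g, fun x hx => ?_, fun x hx => ?_⟩
  · rw [Module.Dual.extendRCLike_apply]
    have h2 := hg' _ (dom.smul_mem Complex.I hx)
    simp only [RCLike.I_to_complex, hg' x hx, h2, map_smul]
    apply Complex.ext <;> simp
  · have h1 : (Module.Dual.extendRCLike (𝕜 := ℂ) g x).re = g x := by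
      rw [Module.Dual.extendRCLike_apply]
      simp
    rw [h1]
    exact hgP x hx

end RieszExtension

/-! ### Complete positivity for a fixed seminorm. -/

section LocalCPAt

variable {A : Type u} [Ring A] [StarRing A] [Algebra ℂ A] {Λ : Type v}
  {H : Type w} [NormedAddCommGroup H] [InnerProductSpace ℂ H]

/-- Complete positivity with respect to a fixed index of the family of seminorms. -/
def IsCPAt (p : Λ → Seminorm ℂ A) (l : Λ) {S : Submodule ℂ A} (φ : S →ₗ[ℂ] (H →L[ℂ] H)) : Prop :=
  ∀ (n : ℕ) (M : Matrix (Fin n) (Fin n) S),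
    (MatrixLocallyNonneg p l (M.map (fun a => (a : A))) → OperatorMatrixNonneg (M.map φ)) ∧
    (MatrixLocallyZero p l (M.map (fun a => (a : A))) → M.map φ = 0)

variable {p : Λ → Seminorm ℂ A} {l : Λ} {S : Submodule ℂ A} {φ : S →ₗ[ℂ] (H →L[ℂ] H)}

theorem IsCPAt.inner_nonneg (hφ : IsCPAt p l φ) {a : S}
    (ha : MatrixLocallyNonneg p l (Matrix.of fun _ _ : Fin 1 => (a : A))) (ξ : H) :
    0 ≤ inner ℂ ξ (φ a ξ) := by
  simpa using (hφ 1 (Matrix.of fun _ _ => a)).1 ha fun _ => ξ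

variable [StarModule ℂ A] [UniformSpace A] [IsUniformAddGroup A] [PartialOrder Λ]
  [CompleteSpace H]

/-- A self-adjoint element plus a large multiple of `1` is positive, so its image has a real
quadratic form. In general, split into real and imaginary parts. -/
theorem IsCPAt.map_star (hA : IsLocallyCStarAlgebra p) (hS : IsLocalOperatorSystem S)
    (hφ : IsCPAt p l φ) (a : S) : φ ⟨star (a : A), hS.star_mem a a.2⟩ = star (φ a) := by
  have hsa : ∀ a : S, star (a : A) = a → star (φ a) = φ a := by
    intro a ha
    obtain ⟨R, hR0, hR⟩ := hA.exists_nonneg_add_smul_one l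
      (M := Matrix.of fun _ _ : Fin 1 => (a : A)) (by ext i j; exact ha)
    obtain ⟨u, hu⟩ : ∃ u : S, (u : A) = 1 := ⟨⟨1, hS.one_mem⟩, rfl⟩
    have h1 := hφ.inner_nonneg (a := u)
      ⟨1, 0, by ext i j; fin_cases i; fin_cases j; simp [hu], fun i j => by simp⟩
    have h2 := hφ.inner_nonneg (a := a + (R : ℂ) • u) (by
      convert hR using 1
      ext i j
      fin_cases i
      fin_cases j
      simp [hu])
    rw [ContinuousLinearMap.star_eq_adjoint, eq_comm]
    refine (ContinuousLinearMap.eq_adjoint_iff _ _).2 ?_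
    refine (LinearMap.isSymmetric_iff_inner_map_self_real (φ a).toLinearMap).2 fun ξ => ?_
    have h3 : (inner ℂ ξ (φ a ξ)).im = 0 := by
      have e := h2 ξ
      have e1 : 0 = (inner ℂ ξ (φ u ξ)).im := (Complex.le_def.1 (h1 ξ)).2
      have e2 := (Complex.le_def.1 e).2
      rw [_root_.map_add, map_smul, _root_.add_apply, _root_.smul_apply, inner_add_right,
        inner_smul_right, Complex.add_im, Complex.im_ofReal_mul, ← e1] at e2
      simpa using e2.symm
    rw [Complex.conj_eq_iff_im]
    rw [← inner_conj_symm, Complex.conj_im]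
    simpa using h3
  set a' : S := ⟨star (a : A), hS.star_mem a a.2⟩ with ha'
  have hh := hsa (a + a') (by simp [ha', add_comm])
  have hk := hsa (Complex.I • (a - a')) (by
    simp [ha', star_smul, sub_eq_add_neg, add_comm])
  simp only [_root_.map_add, map_smul, map_sub, star_add, star_smul, star_sub] at hh hk
  have hk' : star (φ a) - star (φ a') = φ a' - φ a := by
    have := congrArg (fun T => Complex.I • T) hk
    simpa [smul_smul] using this
  have : (2 : ℂ) • φ a' = (2 : ℂ) • star (φ a) := by
    rw [two_smul, two_smul]
    calc φ a' + φ a' = (φ a + φ a') + (φ a' - φ a) := by abel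
      _ = (star (φ a) + star (φ a')) + (star (φ a) - star (φ a')) := by rw [hh, hk']
      _ = star (φ a) + star (φ a) := by abel
  exact smul_right_injective _ two_ne_zero this

end LocalCPAt

/-! ### Finitely supported matrices and the accretive cone. -/

section FiniteMatrices

section NoStar

variable {A : Type u} [Ring A] [Algebra ℂ A]
  {Λ : Type v} {p : Λ → Seminorm ℂ A} {l : Λ} {ι : Type w}

theorem MatrixLocallyZero.add {n : ℕ} {C C' : Matrix (Fin n) (Fin n) A}
    (hC : MatrixLocallyZero p l C) (hC' : MatrixLocallyZero p l C') :
    MatrixLocallyZero p l (C + C') := fun i j =>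
  le_antisymm ((map_add_le_add _ _ _).trans (by rw [hC i j, hC' i j, add_zero]))
    (apply_nonneg _ _)

/-- The matrix with entries `conj (η i) * ξ j • a`. -/
noncomputable def elementary (a : A) (η ξ : ι →₀ ℂ) : ι × ι →₀ A :=
  Finsupp.onFinset (η.support ×ˢ ξ.support) (fun x => (star (η x.1) * ξ x.2) • a) fun x hx => by
    rw [Finset.mem_product, Finsupp.mem_support_iff, Finsupp.mem_support_iff]
    constructor <;> rintro h <;> simp [h] at hx

@[simp]
theorem elementary_apply (a : A) (η ξ : ι →₀ ℂ) (x : ι × ι) :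
    elementary a η ξ x = (star (η x.1) * ξ x.2) • a := rfl

end NoStar

variable {A : Type u} [Ring A] [StarRing A] [Algebra ℂ A]
  {Λ : Type v} {p : Λ → Seminorm ℂ A} {l : Λ} {ι : Type w}

theorem MatrixLocallyZero.conjTranspose (hs : ∀ a, p l (star a) = p l a) {n : ℕ}
    {C : Matrix (Fin n) (Fin n) A} (hC : MatrixLocallyZero p l C) : MatrixLocallyZero p l Cᴴ :=
  fun i j => by rw [Matrix.conjTranspose_apply, hs, hC]

/-- The self-adjoint matrix `X + X⋆`, restricted to a finite family of indices. -/
def hermitianBlock (X : ι × ι →₀ A) {n : ℕ} (e : Fin n → ι) : Matrix (Fin n) (Fin n) A :=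
  Matrix.of fun i j => X (e i, e j) + star (X (e j, e i))

/-- The finitely supported matrices with positive real part. -/
def accretive (p : Λ → Seminorm ℂ A) (l : Λ) (ι : Type w) : Set (ι × ι →₀ A) :=
  {X | ∀ (n : ℕ) (e : Fin n → ι), MatrixLocallyNonneg p l (hermitianBlock X e)}

variable [StarModule ℂ A] [UniformSpace A] [IsUniformAddGroup A] [PartialOrder Λ]

/-- Every block is a 0-1 compression of the block of an enumeration covering the support, so that
one block decides. -/
theorem mem_accretive_of_support (hA : IsLocallyCStarAlgebra p) {X : ι × ι →₀ A} {m : ℕ}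
    {e : Fin m → ι} (he : Function.Injective e)
    (hX : ∀ i j, X (i, j) ≠ 0 → i ∈ Set.range e ∧ j ∈ Set.range e)
    (h : MatrixLocallyNonneg p l (hermitianBlock X e)) : X ∈ accretive p l ι := by
  classical
  intro n e'
  convert hA.nonneg_compress h (fun k i => if e k = e' i then 1 else 0) using 1
  ext i j
  have key : ∀ G : ι → ι → A, (∀ i j, G i j ≠ 0 → i ∈ Set.range e ∧ j ∈ Set.range e) →
      G (e' i) (e' j) = ∑ k, ∑ k', (star (if e k = e' i then (1 : ℂ) else 0) *
        (if e k' = e' j then 1 else 0)) • G (e k) (e k') := by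
    intro G hG
    by_cases h0 : G (e' i) (e' j) = 0
    · rw [h0]
      refine (Finset.sum_eq_zero fun k _ => Finset.sum_eq_zero fun k' _ => ?_).symm
      split_ifs with h1 h2 <;> simp
      rw [h1, h2, h0]
    · obtain ⟨⟨k, hk⟩, ⟨k', hk'⟩⟩ := hG _ _ h0
      rw [Finset.sum_eq_single k, Finset.sum_eq_single k']
      · simp [hk, hk']
      · intro x _ hx
        rw [if_neg (c := e x = e' j) (fun h => hx (he (h.trans hk'.symm)))]
        simp
      · simp
      · intro x _ hx
        rw [if_neg (fun h => hx (he (h.trans hk.symm)))]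
        simp
      · simp
  refine (key (fun i j => X (i, j) + star (X (j, i))) fun i j hij => ?_)
  by_cases h1 : X (i, j) = 0
  · have h2 : X (j, i) ≠ 0 := fun h2 => hij (by simp [h1, h2])
    exact (hX _ _ h2).symm
  · exact hX _ _ h1

/-- Each hermitian block is the compression of `M + Mᴴ` by the coordinates of the `ξ k`. -/
theorem sum_elementary_mem_accretive (hA : IsLocallyCStarAlgebra p) {n : ℕ}
    {M : Matrix (Fin n) (Fin n) A} (hM : MatrixLocallyNonneg p l (M + Mᴴ))
    (ξ : Fin n → ι →₀ ℂ) :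
    ∑ k, ∑ k', elementary (M k k') (ξ k) (ξ k') ∈ accretive p l ι := by
  intro m e
  convert hA.nonneg_compress hM (fun k i => ξ k (e i)) using 1
  ext i j
  simp only [hermitianBlock, Matrix.of_apply, Finsupp.coe_finsetSum, Finset.sum_apply,
    elementary_apply, Matrix.add_apply, Matrix.conjTranspose_apply, smul_add,
    Finset.sum_add_distrib, star_sum, star_smul, star_mul', star_star]
  congr 1
  rw [Finset.sum_comm]
  exact Finset.sum_congr rfl fun k _ => Finset.sum_congr rfl fun k' _ => by rw [mul_comm]

/-- A complex functional which is positive on accretive matrices defines a positive form. -/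
theorem isPositiveForm_of_accretive (hA : IsLocallyCStarAlgebra p) {H : Type*} [AddCommGroup H]
    [Module ℂ H] (b : Module.Basis ι ℂ H) (G : (ι × ι →₀ A) →ₗ[ℂ] ℂ)
    (hG : ∀ X ∈ accretive p l ι, 0 ≤ (G X).re) :
    IsPositiveForm p l fun a η ξ => G (elementary a (b.repr η) (b.repr ξ)) := by
  have hzero : ∀ X : ι × ι →₀ A,
      (∀ (n : ℕ) (e : Fin n → ι), MatrixLocallyZero p l (hermitianBlock X e)) → (G X).re = 0 := by
    intro X hX
    refine le_antisymm ?_ (hG X fun n e => (hX n e).nonneg)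
    have h1 := hG (-X) fun n e => MatrixLocallyZero.nonneg fun i j => by
      have := hX n e i j
      rw [← map_neg_eq_map] at this
      simpa [hermitianBlock, add_comm] using this
    simpa using h1
  have hherm : ∀ X Y : ι × ι →₀ A, (∀ i j, Y (i, j) = star (X (j, i))) → star (G X) = G Y := by
    intro X Y hXY
    -- Here `Y = X⋆`. Both `X - X⋆` and `I(X + X⋆)` are skew-adjoint, so `Re G` vanishes on them;
    -- together this says that `G` is hermitian.
    have h1 := hzero (X - Y) fun n e i j => by
      simp [hermitianBlock, hXY, sub_eq_add_neg, add_comm, add_left_comm]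
    have h2 := hzero (Complex.I • (X + Y)) fun n e i j => by
      have : hermitianBlock (Complex.I • (X + Y)) e i j = 0 := by
        simp [hermitianBlock, hXY]
      rw [this, map_zero]
    apply Complex.ext
    · simp at h1 ⊢
      linarith
    · simp at h2 ⊢
      linarith
  refine ⟨fun a a' η ξ => ?_, fun c a η ξ => ?_, fun a η ξ ξ' => ?_, fun c a η ξ => ?_,
    fun a η ξ => ?_, fun n M hM ξ => ?_⟩
  · rw [← map_add]
    congr 1
    ext x
    simp
  · rw [← smul_eq_mul, ← map_smul]
    congr 1
    ext x
    simp [smul_comm c]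
  · rw [← map_add]
    congr 1
    ext x
    simp [mul_add, add_smul]
  · rw [← smul_eq_mul, ← map_smul]
    congr 1
    ext x
    simp [smul_smul, mul_left_comm]
  · refine hherm _ _ fun i j => ?_
    simp [star_smul, mul_comm]
  · have hs := star_eq_of_cstarSeminorm (hA.mul_le l) (hA.star_mul_self l)
    obtain ⟨B, C, rfl, hC⟩ := hM
    set M := Bᴴ * B + C with hMdef
    have hsum : ∀ c : ℂ, ∑ i, ∑ j, elementary ((c • M) i j) (b.repr (ξ i)) (b.repr (ξ j)) =
        c • ∑ i, ∑ j, elementary (M i j) (b.repr (ξ i)) (b.repr (ξ j)) := by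
      intro c
      simp only [Finset.smul_sum]
      refine Finset.sum_congr rfl fun i _ => Finset.sum_congr rfl fun j _ => ?_
      ext x
      simp [smul_comm c]
    simp only [← map_sum]
    have hBB : MatrixLocallyNonneg p l (Bᴴ * B + C) := ⟨B, C, rfl, hC⟩
    have hBB' : MatrixLocallyNonneg p l ((Bᴴ * B) + Cᴴ) := ⟨B, Cᴴ, rfl, hC.conjTranspose hs⟩
    have hre := hG _ (sum_elementary_mem_accretive hA (M := M) (by
      convert hA.nonneg_add hBB hBB' using 2
      simp [hMdef]) fun i => b.repr (ξ i))
    -- `M` is self-adjoint only modulo `ker p_l`. For `c = ±I` the real part of `c • M` is locally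
    -- zero, and using both signs makes the value of `G` real.
    have him : ∀ c : ℂ, star c = -c →
        0 ≤ (c * G (∑ i, ∑ j, elementary (M i j) (b.repr (ξ i)) (b.repr (ξ j)))).re := by
      intro c hc
      rw [← smul_eq_mul, ← map_smul, ← hsum]
      refine hG _ (sum_elementary_mem_accretive hA (M := c • M) ?_ fun i => b.repr (ξ i))
      refine MatrixLocallyZero.nonneg ?_
      have : c • M + (c • M)ᴴ = c • C + (c • C)ᴴ := by
        simp [hMdef, Matrix.conjTranspose_smul, hc]
        abel
      rw [this]
      have hcC : MatrixLocallyZero p l (c • C) := fun i j => by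
        rw [Matrix.smul_apply, map_smul_eq_mul, hC, mul_zero]
      exact hcC.add (hcC.conjTranspose hs)
    have h1 := him Complex.I (by simp)
    have h2 := him (-Complex.I) (by simp)
    rw [Complex.le_def]
    refine ⟨hre, ?_⟩
    simp at h1 h2 ⊢
    linarith

end FiniteMatrices

/-! ### Arveson's extension theorem. -/

section Arveson

theorem exists_index {A ι : Type*} [Zero A] (X : ι × ι →₀ A) :
    ∃ s : Finset ι, ∀ i j, X (i, j) ≠ 0 → i ∈ s ∧ j ∈ s := by
  classical
  refine ⟨X.support.image Prod.fst ∪ X.support.image Prod.snd, fun i j hij => ?_⟩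
  have := Finsupp.mem_support_iff.2 hij
  exact ⟨Finset.mem_union_left _ (Finset.mem_image_of_mem _ this),
    Finset.mem_union_right _ (Finset.mem_image_of_mem Prod.snd this)⟩

section Functional

variable {A : Type u} [Ring A] [Algebra ℂ A] {H : Type w} [NormedAddCommGroup H]
  [InnerProductSpace ℂ H]

/-- The functional `X ↦ ∑ i, ∑ j, ⟪b i, Φ (X i j) (b j)⟫` on finitely supported matrices. -/
noncomputable def matrixFunctional {ι : Type*} (b : ι → H) (Φ : A →ₗ[ℂ] (H →L[ℂ] H)) :
    (ι × ι →₀ A) →ₗ[ℂ] ℂ :=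
  Finsupp.lsum ℂ fun x : ι × ι =>
    (innerSL ℂ (b x.1)).toLinearMap ∘ₗ (ContinuousLinearMap.apply ℂ H (b x.2)).toLinearMap ∘ₗ Φ

theorem matrixFunctional_apply {ι : Type*} (b : ι → H) (Φ : A →ₗ[ℂ] (H →L[ℂ] H))
    (X : ι × ι →₀ A) :
    matrixFunctional b Φ X = X.sum fun x a => inner ℂ (b x.1) (Φ a (b x.2)) := rfl

theorem matrixFunctional_eq_sum {ι : Type*} (b : ι → H) (Φ : A →ₗ[ℂ] (H →L[ℂ] H))
    (X : ι × ι →₀ A) (s : Finset ι) (hs : ∀ i j, X (i, j) ≠ 0 → i ∈ s ∧ j ∈ s) :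
    matrixFunctional b Φ X = ∑ i ∈ s, ∑ j ∈ s, inner ℂ (b i) (Φ (X (i, j)) (b j)) := by
  rw [matrixFunctional_apply, Finsupp.sum_of_support_subset X (s := s ×ˢ s), Finset.sum_product]
  · rintro ⟨i, j⟩ hx
    exact Finset.mem_product.2 (hs i j (Finsupp.mem_support_iff.1 hx))
  · simp

theorem matrixFunctional_elementary {ι : Type*} (b : Module.Basis ι ℂ H)
    (Φ : A →ₗ[ℂ] (H →L[ℂ] H)) (a : A) (η ξ : H) :
    matrixFunctional b Φ (elementary a (b.repr η) (b.repr ξ)) = inner ℂ η (Φ a ξ) := by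
  classical
  set s := (b.repr η).support ∪ (b.repr ξ).support with hs
  rw [matrixFunctional_eq_sum b Φ _ s]
  · have h : ∀ ζ : H, ∀ s : Finset ι, (b.repr ζ).support ⊆ s → ζ = ∑ i ∈ s, b.repr ζ i • b i := by
      intro ζ s hs
      conv_lhs => rw [← b.linearCombination_repr ζ, Finsupp.linearCombination_apply]
      exact Finsupp.sum_of_support_subset _ hs _ (by simp)
    conv_rhs => rw [h η s Finset.subset_union_left, h ξ s Finset.subset_union_right]
    simp only [elementary_apply, map_sum, map_smul, sum_inner, inner_sum, inner_smul_left,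
      inner_smul_right, _root_.smul_apply, Finset.mul_sum]
    rw [Finset.sum_comm]
    refine Finset.sum_congr rfl fun i _ => Finset.sum_congr rfl fun j _ => ?_
    simp only [Complex.star_def]
    ring
  · intro i j hij
    simp only [elementary_apply, ne_eq, smul_eq_zero, mul_eq_zero, not_or, star_eq_zero] at hij
    simp [hs, hij.1.1, hij.1.2]

end Functional

variable {A : Type u} [Ring A] [StarRing A] [Algebra ℂ A] [StarModule ℂ A] [UniformSpace A]
  [IsUniformAddGroup A] {Λ : Type v} [PartialOrder Λ] {p : Λ → Seminorm ℂ A} {l : Λ}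
  {H : Type w} [NormedAddCommGroup H] [InnerProductSpace ℂ H] {S : Submodule ℂ A}

/-- Adding a large multiple of the identity makes a finitely supported matrix accretive. -/
theorem exists_add_mem_accretive (hA : IsLocallyCStarAlgebra p) {ι : Type*} (l : Λ)
    (h1 : (1 : A) ∈ S) (Y : ι × ι →₀ A) :
    ∃ X : ι × ι →₀ A, (∀ x, X x ∈ S) ∧ X + Y ∈ accretive p l ι := by
  classical
  obtain ⟨s, hs⟩ := exists_index Y
  set e : Fin s.card → ι := fun i => s.equivFin.symm i with he
  have he_inj : Function.Injective e := fun i j h =>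
    s.equivFin.symm.injective (Subtype.ext h)
  have he_range : ∀ i, i ∈ s → i ∈ Set.range e := fun i hi =>
    ⟨s.equivFin ⟨i, hi⟩, by simp [he]⟩
  obtain ⟨R, hR0, hR⟩ := hA.exists_nonneg_add_smul_one l (M := hermitianBlock Y e) (by
    ext i j
    simp [hermitianBlock, add_comm])
  -- The constant is `R / 2` because the hermitian block counts `X` twice.
  set X : ι × ι →₀ A := Finsupp.onFinset (s ×ˢ s)
    (fun x => if x.1 = x.2 ∧ x.1 ∈ s then ((R / 2 : ℝ) : ℂ) • 1 else 0) (fun x hx => by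
      by_contra h
      refine hx (if_neg fun h' => h ?_)
      rw [Finset.mem_product, ← h'.1]
      exact ⟨h'.2, h'.2⟩) with hX
  have hXa : ∀ i j, X (i, j) = if i = j ∧ i ∈ s then ((R / 2 : ℝ) : ℂ) • 1 else 0 :=
    fun i j => rfl
  refine ⟨X, fun x => ?_, mem_accretive_of_support hA he_inj (fun i j hij => ?_) ?_⟩
  · rw [← Prod.mk.eta (p := x), hXa]
    split_ifs
    · exact S.smul_mem _ h1
    · exact S.zero_mem
  · have : i ∈ s ∧ j ∈ s := by
      by_cases hY : Y (i, j) = 0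
      · rw [Finsupp.add_apply, hY, add_zero, hXa] at hij
        split_ifs at hij with h
        · exact ⟨h.2, h.1 ▸ h.2⟩
        · exact absurd rfl hij
      · exact hs i j hY
    exact ⟨he_range _ this.1, he_range _ this.2⟩
  · convert hR using 1
    ext i j
    have hei : e i ∈ s := (s.equivFin.symm i).2
    simp only [hermitianBlock, Matrix.of_apply, Finsupp.add_apply, hXa, Matrix.add_apply,
      Matrix.smul_apply, Matrix.one_apply, he_inj.eq_iff]
    by_cases hij : i = j
    · subst hij
      have hR2 : ((R / 2 : ℝ) : ℂ) • (1 : A) + ((R / 2 : ℝ) : ℂ) • 1 = (R : ℂ) • 1 := by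
        rw [← add_smul]
        congr 1
        push_cast
        ring
      simp only [hei, and_self, if_true, star_add, star_smul, star_one, ← hR2]
      simp
      abel
    · simp [hij, Ne.symm hij]

variable [CompleteSpace H]

/-- The functional attached to a completely positive map is positive. -/
theorem re_matrixFunctional_nonneg (hA : IsLocallyCStarAlgebra p) (hS : IsLocalOperatorSystem S)
    {φ : S →ₗ[ℂ] (H →L[ℂ] H)} (hφ : IsCPAt p l φ) {Φ : A →ₗ[ℂ] (H →L[ℂ] H)}
    (hΦ : ∀ s : S, Φ s = φ s) {ι : Type*} (b : ι → H) {X : ι × ι →₀ A} (hXS : ∀ x, X x ∈ S)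
    (hX : X ∈ accretive p l ι) : 0 ≤ (matrixFunctional b Φ X).re := by
  obtain ⟨s, hs⟩ := exists_index X
  set e := s.equivFin.symm
  have conv : ∀ f : ι → ℂ, ∑ a ∈ s, f a = ∑ i, f (e i) := fun f => by
    rw [← Finset.sum_coe_sort s f, ← Equiv.sum_comp e]
  have hstar : ∀ i j, star (X (i, j)) ∈ S := fun i j => hS.star_mem _ (hXS _)
  have hM := (hφ s.card (Matrix.of fun i j => ⟨X (e i, e j), hXS _⟩ +
    ⟨star (X (e j, e i)), hstar _ _⟩)).1 (hX _ fun i => e i) fun i => b (e i)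
  have hsum : matrixFunctional b Φ X = ∑ i, ∑ j, inner ℂ (b (e i)) (Φ (X (e i, e j)) (b (e j))) := by
    rw [matrixFunctional_eq_sum b Φ X s hs, conv]
    exact Finset.sum_congr rfl fun i _ => conv _
  have h2 : (∑ i, ∑ j, inner ℂ (b (e i)) (((Matrix.of fun i j : Fin s.card =>
      (⟨X (e i, e j), hXS _⟩ : S) + ⟨star (X (e j, e i)), hstar _ _⟩).map φ) i j (b (e j)))) =
      matrixFunctional b Φ X + star (matrixFunctional b Φ X) := by
    rw [hsum, star_sum]
    simp only [Matrix.map_apply, Matrix.of_apply, _root_.map_add, _root_.add_apply,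
      inner_add_right, Finset.sum_add_distrib, star_sum]
    congr 1
    · exact Finset.sum_congr rfl fun i _ => Finset.sum_congr rfl fun j _ => by rw [← hΦ]
    · rw [Finset.sum_comm]
      refine Finset.sum_congr rfl fun i _ => Finset.sum_congr rfl fun j _ => ?_
      have := hφ.map_star hA hS ⟨X (e i, e j), hXS _⟩
      rw [this, ContinuousLinearMap.star_eq_adjoint, ContinuousLinearMap.adjoint_inner_right,
        ← hΦ]
      exact (inner_conj_symm _ _).symm
  have h3 := (Complex.le_def.1 (hM.trans_eq h2)).1
  simp at h3
  linarith

/-- Arveson's extension theorem: a completely positive map on a local operator system is the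
compression of a local representation. -/
theorem IsCPAt.exists_dilation (hA : IsLocallyCStarAlgebra p) (hS : IsLocalOperatorSystem S)
    {φ : S →ₗ[ℂ] (H →L[ℂ] H)} (hφ : IsCPAt p l φ) :
    ∃ (K : Type max u w) (_ : NormedAddCommGroup K) (_ : InnerProductSpace ℂ K)
      (_ : CompleteSpace K) (ρ : A →⋆ₐ[ℂ] (K →L[ℂ] K)) (V : H →L[ℂ] K),
      (∀ a, ‖ρ a‖ ≤ p l a) ∧ ∀ s : S, φ s = V.adjoint ∘L ρ s ∘L V := by
  -- Any linear extension will do: it makes the functional total, and its values off `S` are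
  -- discarded.
  obtain ⟨Φ, hΦ⟩ := φ.exists_extend
  have hΦ' : ∀ s : S, Φ s = φ s := fun s => LinearMap.congr_fun hΦ s
  -- A Hamel basis gives every vector finitely supported coordinates, so the functional is a finite
  -- sum and needs no convergence.
  set b := Module.Basis.ofVectorSpace ℂ H
  set ι := Module.Basis.ofVectorSpaceIndex ℂ H
  let dom : Submodule ℂ (ι × ι →₀ A) :=
    { carrier := {X | ∀ x, X x ∈ S}
      zero_mem' := fun x => S.zero_mem
      add_mem' := fun hX hY x => S.add_mem (hX x) (hY x)
      smul_mem' := fun c X hX x => S.smul_mem c (hX x) }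
  obtain ⟨G, hG, hGP⟩ := exists_complex_riesz_extension (accretive p l ι)
    (fun n e => MatrixLocallyZero.nonneg fun i j => by simp [hermitianBlock])
    (fun X hX Y hY n e => by
      convert hA.nonneg_add (hX n e) (hY n e) using 1
      ext i j
      simp [hermitianBlock, add_add_add_comm])
    (fun r hr X hX n e => by
      convert (hX n e).smul hr using 1
      ext i j
      simp [hermitianBlock])
    dom (matrixFunctional b Φ)
    (fun X hXS hX => re_matrixFunctional_nonneg hA hS hφ hΦ' b hXS hX)
    (fun Y => exists_add_mem_accretive hA l hS.one_mem Y)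
  have hF := isPositiveForm_of_accretive hA b G hGP
  have hGS : ∀ (s : S) η ξ, G (elementary (s : A) (b.repr η) (b.repr ξ)) = inner ℂ η (φ s ξ) := by
    intro s η ξ
    rw [hG _ fun x => S.smul_mem _ s.2, matrixFunctional_elementary, hΦ']
  obtain ⟨K, _, _, _, ρ, V, hρ, hV, -⟩ := hF.exists_dilation hA ‖φ ⟨1, hS.one_mem⟩‖ (fun ξ => by
    rw [hGS ⟨1, hS.one_mem⟩]
    refine (Complex.re_le_norm _).trans ((norm_inner_le_norm _ _).trans ?_)
    have := (φ ⟨1, hS.one_mem⟩).le_opNorm ξ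
    nlinarith [norm_nonneg ξ])
  refine ⟨K, _, _, inferInstance, ρ, V, hρ, fun s => ?_⟩
  ext ξ
  refine ext_inner_left ℂ fun η => ?_
  rw [← hGS, hV]
  simp [ContinuousLinearMap.adjoint_inner_right]

end Arveson

/-! ### Compressions of representations and intertwining. -/

section Compression

variable {A : Type u} [Ring A] [StarRing A] [Algebra ℂ A] {Λ : Type v} {p : Λ → Seminorm ℂ A}
  {l : Λ} {H K : Type*} [NormedAddCommGroup H] [InnerProductSpace ℂ H]
  [NormedAddCommGroup K] [InnerProductSpace ℂ K] [CompleteSpace K] {S : Submodule ℂ A}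

/-- Since `T` commutes with `ρ`, the sum is `∑ k, ⟪y k, T (y k)⟫` with `y k = ∑ j, ρ (B k j) (V (ξ
j))`. -/
theorem sum_inner_compression_nonneg {ρ : A →⋆ₐ[ℂ] (K →L[ℂ] K)} (hρ : ∀ a, ‖ρ a‖ ≤ p l a)
    {T : K →L[ℂ] K} (hT : T.IsPositive) (hc : ∀ a, T * ρ a = ρ a * T) (V : H →L[ℂ] K) {n : ℕ}
    {M : Matrix (Fin n) (Fin n) A} (hM : MatrixLocallyNonneg p l M) (ξ : Fin n → H) :
    0 ≤ ∑ i, ∑ j, inner ℂ (V (ξ i)) (T (ρ (M i j) (V (ξ j)))) := by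
  obtain ⟨B, C, rfl, hC⟩ := hM
  have h0 : ∀ i j, ρ (C i j) = 0 := fun i j =>
    norm_le_zero_iff.1 ((hρ _).trans (hC i j).le)
  have h1 : ∀ a x, T (ρ a x) = ρ a (T x) := fun a x =>
    congrArg (fun R : K →L[ℂ] K => R x) (hc a)
  have h2 : ∀ i j, inner ℂ (V (ξ i)) (T (ρ ((Bᴴ * B + C) i j) (V (ξ j)))) =
      ∑ k, inner ℂ (ρ (B k i) (V (ξ i))) (T (ρ (B k j) (V (ξ j)))) := by
    intro i j
    simp only [Matrix.add_apply, Matrix.mul_apply, Matrix.conjTranspose_apply, map_add, map_sum,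
      map_mul, h0, add_zero, sum_apply, inner_sum, mul_apply_eq_comp, map_star]
    refine Finset.sum_congr rfl fun k _ => ?_
    rw [← map_star, h1, map_star, ContinuousLinearMap.star_eq_adjoint,
      ContinuousLinearMap.adjoint_inner_right]
  simp only [h2]
  have h3 : ∑ i, ∑ j, ∑ k, inner ℂ (ρ (B k i) (V (ξ i))) (T (ρ (B k j) (V (ξ j)))) =
      ∑ k, inner ℂ (∑ i, ρ (B k i) (V (ξ i))) (T (∑ j, ρ (B k j) (V (ξ j)))) := by
    simp only [map_sum, sum_inner, inner_sum]
    rw [Finset.sum_congr rfl fun i _ => Finset.sum_comm, Finset.sum_comm]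
    exact Finset.sum_congr rfl fun k _ => Finset.sum_comm
  rw [h3]
  exact Finset.sum_nonneg fun k _ => hT.inner_nonneg_right _

theorem IsCPAt.mono {φ : S →ₗ[ℂ] (H →L[ℂ] H)} (hφ : IsCPAt p l φ) {l' : Λ}
    (h : ∀ a, p l a ≤ p l' a) : IsCPAt p l' φ := by
  have h0 : ∀ {n : ℕ} {C : Matrix (Fin n) (Fin n) A}, MatrixLocallyZero p l' C →
      MatrixLocallyZero p l C := fun hC i j =>
    le_antisymm ((h _).trans (hC i j).le) (apply_nonneg _ _)
  refine fun n M => ⟨fun hM => (hφ n M).1 ?_, fun hM => (hφ n M).2 (h0 hM)⟩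
  obtain ⟨B, C, hBC, hC⟩ := hM
  exact ⟨B, C, hBC, h0 hC⟩

theorem IsCPAt.add {φ ψ : S →ₗ[ℂ] (H →L[ℂ] H)} (hφ : IsCPAt p l φ) (hψ : IsCPAt p l ψ) :
    IsCPAt p l (φ + ψ) := by
  refine fun n M => ⟨fun hM ξ => ?_, fun hM => ?_⟩
  · have := add_nonneg ((hφ n M).1 hM ξ) ((hψ n M).1 hM ξ)
    simpa only [Matrix.map_apply, LinearMap.add_apply, add_apply, inner_add_right,
      Finset.sum_add_distrib] using this
  · ext i j ξ
    have h1 := congrFun (congrFun ((hφ n M).2 hM) i) j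
    have h2 := congrFun (congrFun ((hψ n M).2 hM) i) j
    simp only [Matrix.map_apply, Matrix.zero_apply] at h1 h2
    simp [h1, h2]

variable [CompleteSpace H]

/-- The map `s ↦ V⋆ T ρ(s) V`. -/
noncomputable def compression (S : Submodule ℂ A) (ρ : A →⋆ₐ[ℂ] (K →L[ℂ] K)) (T : K →L[ℂ] K)
    (V : H →L[ℂ] K) : S →ₗ[ℂ] (H →L[ℂ] H) where
  toFun s := V.adjoint ∘L (T ∘L ρ s) ∘L V
  map_add' s t := by ext; simp
  map_smul' c s := by ext; simp

theorem inner_compression (ρ : A →⋆ₐ[ℂ] (K →L[ℂ] K)) (T : K →L[ℂ] K) (V : H →L[ℂ] K) (s : S)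
    (η ξ : H) : inner ℂ η (compression S ρ T V s ξ) = inner ℂ (V η) (T (ρ s (V ξ))) := by
  simp [compression, ContinuousLinearMap.adjoint_inner_right]

theorem isCPAt_compression {ρ : A →⋆ₐ[ℂ] (K →L[ℂ] K)} (hρ : ∀ a, ‖ρ a‖ ≤ p l a)
    {T : K →L[ℂ] K} (hT : T.IsPositive) (hc : ∀ a, T * ρ a = ρ a * T) (V : H →L[ℂ] K) :
    IsCPAt p l (compression S ρ T V) := by
  refine fun n M => ⟨fun hM ξ => ?_, fun hM => ?_⟩
  · simp only [Matrix.map_apply, inner_compression]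
    exact sum_inner_compression_nonneg hρ hT hc V hM ξ
  · ext i j ξ
    have h0 : ρ (M i j : A) = 0 := norm_le_zero_iff.1 ((hρ _).trans (hM i j).le)
    simp [compression, h0]

theorem isPositiveForm_compression {ρ : A →⋆ₐ[ℂ] (K →L[ℂ] K)} (hρ : ∀ a, ‖ρ a‖ ≤ p l a)
    {T : K →L[ℂ] K} (hT : T.IsPositive) (hc : ∀ a, T * ρ a = ρ a * T) (V : H →L[ℂ] K) :
    IsPositiveForm p l fun a η ξ => inner ℂ (V η) (T (ρ a (V ξ))) where
  map_add a b η ξ := by simp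
  map_smul c a η ξ := by simp
  add_right a η ξ ξ' := by simp
  smul_right c a η ξ := by simp
  symm a η ξ := by
    have h1 : T (ρ a (V ξ)) = ρ a (T (V ξ)) :=
      congrArg (fun R : K →L[ℂ] K => R (V ξ)) (hc a)
    rw [h1, map_star, ContinuousLinearMap.star_eq_adjoint, ← hT.isSelfAdjoint.adjoint_eq,
      ContinuousLinearMap.adjoint_inner_right, ContinuousLinearMap.adjoint_inner_right,
      hT.isSelfAdjoint.adjoint_eq, ← inner_conj_symm, Complex.star_def, Complex.conj_conj,
      ← ContinuousLinearMap.adjoint_inner_left, ← hT.isSelfAdjoint.adjoint_eq]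
  nonneg n M hM ξ := sum_inner_compression_nonneg hρ hT hc V hM ξ

theorem restrict_eq_compression (π : A →⋆ₐ[ℂ] (H →L[ℂ] H)) (S : Submodule ℂ A) :
    restrict π S = compression S π 1 1 := by
  ext s ξ
  refine ext_inner_left ℂ fun η => ?_
  rw [inner_compression]
  rfl

theorem IsLocalRep.isLocalCP_restrict {π : A →⋆ₐ[ℂ] (H →L[ℂ] H)} (hπ : IsLocalRep p π)
    (S : Submodule ℂ A) : IsLocalCP p (restrict π S) := by
  obtain ⟨l, hl⟩ := hπ
  rw [restrict_eq_compression]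
  exact ⟨l, isCPAt_compression hl ContinuousLinearMap.isPositive_one (fun a => by simp) 1⟩

theorem inner_adjoint_comp_comp (R : K →L[ℂ] K) (V : H →L[ℂ] K) (x y : H) :
    inner ℂ x ((V.adjoint ∘L R ∘L V) y) = inner ℂ (V x) (R (V y)) :=
  ContinuousLinearMap.adjoint_inner_right V x _

/-- The right-hand side involves only the compression `V⋆ ρ(·) V`, so it can be summed over several
dilations. -/
theorem sq_norm_sub_compression (ρ : A →⋆ₐ[ℂ] (K →L[ℂ] K)) (V : H →L[ℂ] K) (b : A) (x ξ : H) :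
    ((‖V x - ρ b (V ξ)‖ ^ 2 : ℝ) : ℂ) =
      inner ℂ x ((V.adjoint ∘L ρ 1 ∘L V) x) - inner ℂ x ((V.adjoint ∘L ρ b ∘L V) ξ) -
        inner ℂ ξ ((V.adjoint ∘L ρ (star b) ∘L V) x) +
        inner ℂ ξ ((V.adjoint ∘L ρ (star b * b) ∘L V) ξ) := by
  have h := inner_self_eq_norm_sq_to_K (𝕜 := ℂ) (V x - ρ b (V ξ))
  rw [Complex.ofReal_pow]
  refine h.symm.trans ?_
  iterate 4 rw [inner_adjoint_comp_comp]
  simp only [inner_sub_left, inner_sub_right, map_mul, map_star, map_one,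
    one_apply_eq_self, mul_apply_eq_comp, ContinuousLinearMap.star_eq_adjoint,
    ContinuousLinearMap.adjoint_inner_right]
  ring

/-- If two compressions add up to a representation, the compressing operators intertwine. -/
theorem intertwines_of_compression_add {K' : Type*} [NormedAddCommGroup K']
    [InnerProductSpace ℂ K'] [CompleteSpace K'] {π : A →⋆ₐ[ℂ] (H →L[ℂ] H)}
    {ρ : A →⋆ₐ[ℂ] (K →L[ℂ] K)} {ρ' : A →⋆ₐ[ℂ] (K' →L[ℂ] K')} {V : H →L[ℂ] K} {V' : H →L[ℂ] K'}
    (h : ∀ a, V.adjoint ∘L ρ a ∘L V + V'.adjoint ∘L ρ' a ∘L V' = π a) (b : A) (ξ : H) :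
    V (π b ξ) = ρ b (V ξ) := by
  have h1 := sq_norm_sub_compression ρ V b (π b ξ) ξ
  have h2 := sq_norm_sub_compression ρ' V' b (π b ξ) ξ
  have key : ∀ a (x y : H), inner ℂ x ((V.adjoint ∘L ρ a ∘L V) y) +
      inner ℂ x ((V'.adjoint ∘L ρ' a ∘L V') y) = inner ℂ x (π a y) := by
    intro a x y
    rw [← h a, add_apply, inner_add_right]
  have h3 : ((‖V (π b ξ) - ρ b (V ξ)‖ ^ 2 + ‖V' (π b ξ) - ρ' b (V' ξ)‖ ^ 2 : ℝ) : ℂ) = 0 := by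
    rw [Complex.ofReal_add, h1, h2]
    -- The same expression for `π` itself, with the identity as compressing operator: it is `‖π b ξ
    -- - π b ξ‖²`.
    have e : inner ℂ (π b ξ) (π 1 (π b ξ)) - inner ℂ (π b ξ) (π b ξ) -
        inner ℂ ξ (π (star b) (π b ξ)) + inner ℂ ξ (π (star b * b) ξ) = 0 := by
      simp
    rw [← e, ← key, ← key, ← key, ← key]
    ring
  have h4 : ‖V (π b ξ) - ρ b (V ξ)‖ ^ 2 + ‖V' (π b ξ) - ρ' b (V' ξ)‖ ^ 2 = 0 := by
    exact_mod_cast h3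
  have h5 : ‖V (π b ξ) - ρ b (V ξ)‖ ^ 2 = 0 :=
    le_antisymm ((le_add_of_nonneg_right (sq_nonneg _)).trans h4.le) (sq_nonneg _)
  rw [pow_eq_zero_iff two_ne_zero, norm_eq_zero, sub_eq_zero] at h5
  exact h5

theorem intertwines_of_compression {π : A →⋆ₐ[ℂ] (H →L[ℂ] H)} {ρ : A →⋆ₐ[ℂ] (K →L[ℂ] K)}
    {V : H →L[ℂ] K} (h : ∀ a, V.adjoint ∘L ρ a ∘L V = π a) (b : A) (ξ : H) :
    V (π b ξ) = ρ b (V ξ) :=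
  intertwines_of_compression_add (ρ' := π) (V' := 0) (fun a => by simp [h a]) b ξ

end Compression

/-! ### Boundary representations are finite, separated and pure on `S`. -/

section Forward

variable {A : Type u} [Ring A] [StarRing A] [Algebra ℂ A]
  {Λ : Type v} {p : Λ → Seminorm ℂ A} {H : Type w} [NormedAddCommGroup H]
  [InnerProductSpace ℂ H] [CompleteSpace H] {S : Submodule ℂ A} {π : A →⋆ₐ[ℂ] (H →L[ℂ] H)}

theorem adjoint_intertwines {K : Type*} [NormedAddCommGroup K] [InnerProductSpace ℂ K]
    [CompleteSpace K] {ρ : A →⋆ₐ[ℂ] (K →L[ℂ] K)} {V : H →L[ℂ] K}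
    (h : ∀ a ξ, V (π a ξ) = ρ a (V ξ)) (a : A) (x : K) :
    V.adjoint (ρ a x) = π a (V.adjoint x) := by
  refine ext_inner_left ℂ fun η => ?_
  rw [ContinuousLinearMap.adjoint_inner_right, ← ContinuousLinearMap.adjoint_inner_left,
    ← ContinuousLinearMap.star_eq_adjoint, ← map_star, ← h,
    ← ContinuousLinearMap.adjoint_inner_right, map_star, ContinuousLinearMap.star_eq_adjoint,
    ContinuousLinearMap.adjoint_inner_left]

/-- A dilation of a boundary representation on `S` is a dilation on the whole algebra. -/
theorem IsLocalBoundaryRep.compression_eq (hb : IsLocalBoundaryRep p S π) {K : Type*}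
    [NormedAddCommGroup K] [InnerProductSpace ℂ K] [CompleteSpace K] {ρ : A →⋆ₐ[ℂ] (K →L[ℂ] K)}
    (hρ : IsLocalRep p ρ) {V : H →L[ℂ] K} (hV : ∀ a ∈ S, π a = V.adjoint ∘L ρ a ∘L V) (a : A) :
    V.adjoint ∘L ρ a ∘L V = π a := by
  obtain ⟨l, hl⟩ := hρ
  have h := hb.2.2 (compression ⊤ ρ 1 V) ⟨l, isCPAt_compression hl
    ContinuousLinearMap.isPositive_one (fun a => by simp) V⟩ fun a ha => (hV a ha).symm
  exact LinearMap.congr_fun h ⟨a, trivial⟩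

/-- By uniqueness `V⋆ π V = π` on all of `A`, so `V` commutes with `π` and is a scalar isometry. -/
theorem IsLocalBoundaryRep.isFiniteLocalRep [Nontrivial H] (hb : IsLocalBoundaryRep p S π) :
    IsFiniteLocalRep p S π := by
  refine ⟨hb.1.1, fun V hV hVS => ?_⟩
  obtain ⟨c, hc⟩ := hb.1.2 V fun a => by
    ext ξ
    exact intertwines_of_compression (hb.compression_eq hb.1.1 hVS) a ξ
  have h1 : star V * V = 1 :=
    ContinuousLinearMap.norm_map_iff_adjoint_comp_self V |>.1
      ((AddMonoidHomClass.isometry_iff_norm V).1 hV)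
  refine Unitary.mem_iff.2 ⟨h1, ?_⟩
  rw [← h1, hc, star_smul, star_one]
  simp [smul_smul, mul_comm]

/-- `V` intertwines, so `V V⋆` lies in the commutant of `ρ`. It is a nonzero scalar projection,
hence `1`, and `V` is onto. -/
theorem IsLocalBoundaryRep.separates [Nontrivial H] (hb : IsLocalBoundaryRep p S π) :
    Separates p S π := by
  intro K _ _ _ ρ V hρ hV hVS
  have hint := intertwines_of_compression (hb.compression_eq hρ.1 hVS)
  have h1 : V.adjoint ∘L V = 1 :=
    ContinuousLinearMap.norm_map_iff_adjoint_comp_self V |>.1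
      ((AddMonoidHomClass.isometry_iff_norm V).1 hV)
  have h1' : ∀ ξ, V.adjoint (V ξ) = ξ := fun ξ => congrArg (fun T : H →L[ℂ] H => T ξ) h1
  have hadj := adjoint_intertwines hint
  obtain ⟨c, hc⟩ := hρ.2 (V ∘L V.adjoint) fun a => by
    ext x
    change V (V.adjoint (ρ a x)) = ρ a (V (V.adjoint x))
    rw [hadj, hint]
  obtain ⟨ξ, hξ⟩ := exists_ne (0 : H)
  have hc1 : c = 1 := by
    have h2 : V (V.adjoint (V ξ)) = c • V ξ := congrArg (fun T : K →L[ℂ] K => T (V ξ)) hc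
    rw [h1'] at h2
    have h3 : V ξ ≠ 0 := fun h => hξ (by rw [← h1' ξ, h, map_zero])
    have h4 : (1 - c) • V ξ = 0 := by rw [sub_smul, one_smul, ← h2, sub_self]
    exact (sub_eq_zero.1 ((smul_eq_zero.1 h4).resolve_right h3)).symm
  have hsurj : Function.Surjective V := fun x => ⟨V.adjoint x, by
    have : V (V.adjoint x) = c • x := congrArg (fun T : K →L[ℂ] K => T x) hc
    rw [this, hc1, one_smul]⟩
  refine ⟨LinearIsometryEquiv.ofSurjective
    ⟨V.toLinearMap, (AddMonoidHomClass.isometry_iff_norm V).1 hV⟩ hsurj, fun a ξ => ?_⟩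
  exact hint a ξ

/-- Arveson extensions of `ψ` and `π|_S - ψ` add up to an extension of `π|_S`, hence to `π`. So `V₁`
intertwines, and the scalar `V₁⋆ V₁` is the required factor. -/
theorem IsLocalBoundaryRep.isPureLocalCP [Nontrivial H] [StarModule ℂ A]
    [UniformSpace A] [IsUniformAddGroup A]
    [PartialOrder Λ] (hA : IsLocallyCStarAlgebra p) (hS : IsLocalOperatorSystem S)
    (hb : IsLocalBoundaryRep p S π) : IsPureLocalCP p (restrict π S) := by
  refine ⟨hb.1.1.isLocalCP_restrict S, fun ψ hψ hψ' => ?_⟩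
  obtain ⟨l₁, h₁⟩ := hψ
  obtain ⟨l₂, h₂⟩ := hψ'
  have := hA.directed
  have := hA.nonempty
  obtain ⟨l, hl₁, hl₂⟩ := exists_ge_ge l₁ l₂
  obtain ⟨K₁, _, _, _, ρ₁, V₁, hρ₁, hV₁⟩ :=
    (IsCPAt.mono h₁ (hA.mono _ _ hl₁)).exists_dilation hA hS
  obtain ⟨K₂, _, _, _, ρ₂, V₂, hρ₂, hV₂⟩ :=
    (IsCPAt.mono h₂ (hA.mono _ _ hl₂)).exists_dilation hA hS
  have hsum : ∀ a, V₁.adjoint ∘L ρ₁ a ∘L V₁ + V₂.adjoint ∘L ρ₂ a ∘L V₂ = π a := by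
    have h := hb.2.2 (compression ⊤ ρ₁ 1 V₁ + compression ⊤ ρ₂ 1 V₂)
      ⟨l, (isCPAt_compression hρ₁ ContinuousLinearMap.isPositive_one (fun a => by simp) V₁).add
        (isCPAt_compression hρ₂ ContinuousLinearMap.isPositive_one (fun a => by simp) V₂)⟩
      fun a ha => by
        have e1 := hV₁ ⟨a, ha⟩
        have e2 := hV₂ ⟨a, ha⟩
        change V₁.adjoint ∘L ρ₁ a ∘L V₁ + V₂.adjoint ∘L ρ₂ a ∘L V₂ = π a
        rw [← e1, ← e2, LinearMap.sub_apply, add_sub_cancel]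
        rfl
    exact fun a => LinearMap.congr_fun h ⟨a, trivial⟩
  have hint := intertwines_of_compression_add hsum
  have hadj := adjoint_intertwines hint
  obtain ⟨c, hc⟩ := hb.1.2 (V₁.adjoint ∘L V₁) fun a => by
    ext ξ
    change V₁.adjoint (V₁ (π a ξ)) = π a (V₁.adjoint (V₁ ξ))
    rw [hint, hadj]
  have hc' : ∀ ξ, V₁.adjoint (V₁ ξ) = c • ξ := fun ξ => congrArg (fun T : H →L[ℂ] H => T ξ) hc
  obtain ⟨ξ, hξ⟩ := exists_ne (0 : H)
  have hξ' : (‖ξ‖ : ℂ) ^ 2 ≠ 0 := pow_ne_zero 2 (by exact_mod_cast norm_ne_zero_iff.2 hξ)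
  have hnorm : c * (‖ξ‖ : ℂ) ^ 2 = (‖V₁ ξ‖ : ℂ) ^ 2 := by
    have h1 := inner_self_eq_norm_sq_to_K (𝕜 := ℂ) (V₁ ξ)
    rw [← ContinuousLinearMap.adjoint_inner_right, hc', inner_smul_right,
      inner_self_eq_norm_sq_to_K] at h1
    exact h1
  have hnorm_add : ‖V₁ ξ‖ ^ 2 + ‖V₂ ξ‖ ^ 2 = ‖ξ‖ ^ 2 := by
    have h1 : inner ℂ ξ ((V₁.adjoint ∘L ρ₁ 1 ∘L V₁ + V₂.adjoint ∘L ρ₂ 1 ∘L V₂) ξ) =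
        inner ℂ ξ (π 1 ξ) := by rw [hsum]
    rw [add_apply, inner_add_right, inner_adjoint_comp_comp, inner_adjoint_comp_comp, map_one,
      map_one, map_one] at h1
    simp only [one_apply_eq_self, inner_self_eq_norm_sq_to_K] at h1
    exact_mod_cast h1
  have hξpos : 0 < ‖ξ‖ ^ 2 := by have := norm_pos_iff.2 hξ; positivity
  -- This is the scalar `c`, read off from `⟪ξ, V₁⋆ V₁ ξ⟫`, which shows that it is real and in `[0,
  -- 1]`.
  refine ⟨‖V₁ ξ‖ ^ 2 / ‖ξ‖ ^ 2, by positivity, ?_, ?_⟩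
  · rw [div_le_one hξpos, ← hnorm_add]
    exact le_add_of_nonneg_right (sq_nonneg _)
  · have hct : c = ((‖V₁ ξ‖ ^ 2 / ‖ξ‖ ^ 2 : ℝ) : ℂ) := by
      push_cast
      rw [eq_div_iff hξ', hnorm]
    rw [← hct]
    ext s ζ
    rw [hV₁]
    change V₁.adjoint (ρ₁ s (V₁ ζ)) = c • π s ζ
    rw [← hint, hc']

end Forward

/-! ### The compact convex set of completely positive extensions. -/

section Extensions

variable {A : Type u} [Ring A] [StarRing A] [Algebra ℂ A] {Λ : Type v} {p : Λ → Seminorm ℂ A}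
  {l : Λ} {H : Type w}

/-- For pointwise convergence: each condition is closed and involves finitely many values of `F`. -/
theorem isClosed_setOf_isPositiveForm [AddCommGroup H] [Module ℂ H] :
    IsClosed {F : A → H → H → ℂ | IsPositiveForm p l F} := by
  have hc : ∀ (a : A) (η ξ : H), Continuous fun F : A → H → H → ℂ => F a η ξ := fun a η ξ => by
    fun_prop
  have : {F : A → H → H → ℂ | IsPositiveForm p l F} =
      {F | ∀ a b η ξ, F (a + b) η ξ = F a η ξ + F b η ξ} ∩
      {F | ∀ (c : ℂ) a η ξ, F (c • a) η ξ = c * F a η ξ} ∩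
      {F | ∀ a η ξ ξ', F a η (ξ + ξ') = F a η ξ + F a η ξ'} ∩
      {F | ∀ (c : ℂ) a η ξ, F a η (c • ξ) = c * F a η ξ} ∩
      {F | ∀ a η ξ, star (F a η ξ) = F (star a) ξ η} ∩
      {F | ∀ (n : ℕ) (M : Matrix (Fin n) (Fin n) A), MatrixLocallyNonneg p l M →
        ∀ ξ : Fin n → H, 0 ≤ ∑ i, ∑ j, F (M i j) (ξ i) (ξ j)} := by
    ext F
    exact ⟨fun h => ⟨⟨⟨⟨⟨h.1, h.2⟩, h.3⟩, h.4⟩, h.5⟩, h.6⟩,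
      fun h => ⟨h.1.1.1.1.1, h.1.1.1.1.2, h.1.1.1.2, h.1.1.2, h.1.2, h.2⟩⟩
  rw [this]
  simp only [Set.ofPred_forall]
  refine (((((IsClosed.inter ?_ ?_).inter ?_).inter ?_).inter ?_).inter ?_)
  · exact isClosed_iInter fun a => isClosed_iInter fun b => isClosed_iInter fun η =>
      isClosed_iInter fun ξ => isClosed_eq (hc _ _ _) ((hc _ _ _).add (hc _ _ _))
  · exact isClosed_iInter fun c => isClosed_iInter fun a => isClosed_iInter fun η =>
      isClosed_iInter fun ξ => isClosed_eq (hc _ _ _) (continuous_const.mul (hc _ _ _))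
  · exact isClosed_iInter fun a => isClosed_iInter fun η => isClosed_iInter fun ξ =>
      isClosed_iInter fun ξ' => isClosed_eq (hc _ _ _) ((hc _ _ _).add (hc _ _ _))
  · exact isClosed_iInter fun c => isClosed_iInter fun a => isClosed_iInter fun η =>
      isClosed_iInter fun ξ => isClosed_eq (hc _ _ _) (continuous_const.mul (hc _ _ _))
  · exact isClosed_iInter fun a => isClosed_iInter fun η => isClosed_iInter fun ξ =>
      isClosed_eq (hc _ _ _).star (hc _ _ _)
  · exact isClosed_iInter fun n => isClosed_iInter fun M => isClosed_iInter fun _ =>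
      isClosed_iInter fun ξ => isClosed_le continuous_const
        (continuous_finsetSum _ fun i _ => continuous_finsetSum _ fun j _ => hc _ _ _)

theorem IsPositiveForm.add [AddCommGroup H] [Module ℂ H] {F G : A → H → H → ℂ}
    (hF : IsPositiveForm p l F) (hG : IsPositiveForm p l G) : IsPositiveForm p l (F + G) where
  map_add a b η ξ := by simp only [Pi.add_apply, hF.map_add, hG.map_add]; ring
  map_smul c a η ξ := by simp only [Pi.add_apply, hF.map_smul, hG.map_smul]; ring
  add_right a η ξ ξ' := by simp only [Pi.add_apply, hF.add_right, hG.add_right]; ring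
  smul_right c a η ξ := by simp only [Pi.add_apply, hF.smul_right, hG.smul_right]; ring
  symm a η ξ := by simp only [Pi.add_apply, star_add, hF.symm, hG.symm]
  nonneg n M hM ξ := by
    simpa only [Pi.add_apply, Finset.sum_add_distrib] using
      add_nonneg (hF.nonneg n M hM ξ) (hG.nonneg n M hM ξ)

theorem IsPositiveForm.real_smul [AddCommGroup H] [Module ℂ H] {F : A → H → H → ℂ}
    (hF : IsPositiveForm p l F) {r : ℝ} (hr : 0 ≤ r) : IsPositiveForm p l (r • F) where
  map_add a b η ξ := by simp only [Pi.smul_apply, hF.map_add, smul_add]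
  map_smul c a η ξ := by simp only [Pi.smul_apply, hF.map_smul, mul_smul_comm]
  add_right a η ξ ξ' := by simp only [Pi.smul_apply, hF.add_right, smul_add]
  smul_right c a η ξ := by simp only [Pi.smul_apply, hF.smul_right, mul_smul_comm]
  symm a η ξ := by simp only [Pi.smul_apply, star_smul, hF.symm, star_trivial]
  nonneg n M hM ξ := by
    simpa only [Pi.smul_apply, ← Finset.smul_sum] using smul_nonneg hr (hF.nonneg n M hM ξ)

variable [NormedAddCommGroup H] [InnerProductSpace ℂ H]

/-- The forms of the completely positive extensions, with respect to `≥_l`, of `π|_S`. -/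
def extensions (p : Λ → Seminorm ℂ A) (l : Λ) (S : Submodule ℂ A) (π : A → H →L[ℂ] H) :
    Set (A → H → H → ℂ) :=
  {F | IsPositiveForm p l F ∧ ∀ s ∈ S, ∀ η ξ, F s η ξ = inner ℂ η (π s ξ)}

variable {S : Submodule ℂ A} {π : A → H →L[ℂ] H}

theorem isClosed_extensions : IsClosed (extensions p l S π) := by
  have h : IsClosed {F : A → H → H → ℂ | ∀ s ∈ S, ∀ η ξ, F s η ξ = inner ℂ η (π s ξ)} := by
    simp only [Set.ofPred_forall]
    exact isClosed_iInter fun s => isClosed_iInter fun _ => isClosed_iInter fun η =>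
      isClosed_iInter fun ξ => isClosed_eq (by fun_prop) continuous_const
  exact isClosed_setOf_isPositiveForm.inter h

theorem convex_extensions : Convex ℝ (extensions p l S π) := by
  intro F hF G hG r t hr ht hrt
  refine ⟨(hF.1.real_smul hr).add (hG.1.real_smul ht), fun s hs η ξ => ?_⟩
  simp only [Pi.add_apply, Pi.smul_apply, hF.2 s hs, hG.2 s hs, ← add_smul, hrt, one_smul]

variable [StarModule ℂ A] [UniformSpace A] [IsUniformAddGroup A] [PartialOrder Λ]

/-- `F 1` is the inner product of `H`, which makes the Stinespring operator isometric. -/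
theorem exists_dilation_of_mem_extensions (hA : IsLocallyCStarAlgebra p) (h1 : (1 : A) ∈ S)
    (hπ1 : π 1 = 1) {F : A → H → H → ℂ} (hF : F ∈ extensions p l S π) :
    ∃ (K : Type max u w) (_ : NormedAddCommGroup K) (_ : InnerProductSpace ℂ K)
      (_ : CompleteSpace K) (ρ : A →⋆ₐ[ℂ] (K →L[ℂ] K)) (V : H →L[ℂ] K),
      (∀ a, ‖ρ a‖ ≤ p l a) ∧ (∀ a η ξ, F a η ξ = inner ℂ (V η) (ρ a (V ξ))) ∧
      Dense (Submodule.span ℂ (Set.range fun x : A × H => ρ x.1 (V x.2)) : Set K) ∧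
      ∀ ξ, ‖V ξ‖ = ‖ξ‖ := by
  have hF1 : ∀ ξ, F 1 ξ ξ = (‖ξ‖ : ℂ) ^ 2 := fun ξ => by
    rw [hF.2 1 h1, hπ1, one_apply_eq_self, inner_self_eq_norm_sq_to_K]
    rfl
  obtain ⟨K, _, _, _, ρ, V, hρ, hV, hd⟩ := hF.1.exists_dilation hA 1 (fun ξ => by
    rw [hF1, one_mul, ← Complex.ofReal_pow, Complex.ofReal_re])
  refine ⟨K, _, _, inferInstance, ρ, V, hρ, hV, hd, fun ξ => ?_⟩
  have h := hV 1 ξ ξ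
  rw [hF1, map_one, one_apply_eq_self, inner_self_eq_norm_sq_to_K] at h
  have h' : ‖ξ‖ ^ 2 = ‖V ξ‖ ^ 2 := Complex.ofReal_injective (by
    rw [Complex.ofReal_pow, Complex.ofReal_pow]
    exact h)
  exact ((sq_eq_sq₀ (norm_nonneg _) (norm_nonneg _)).1 h').symm

/-- The isometric dilation bounds each value by `p l a * ‖η‖ * ‖ξ‖`, so Tychonoff's theorem applies.
-/
theorem isCompact_extensions (hA : IsLocallyCStarAlgebra p) (h1 : (1 : A) ∈ S)
    (hπ1 : π 1 = 1) : IsCompact (extensions p l S π) := by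
  refine IsCompact.of_isClosed_subset (isCompact_univ_pi fun a => isCompact_univ_pi fun η =>
    isCompact_univ_pi fun ξ => isCompact_closedBall (0 : ℂ) (p l a * ‖η‖ * ‖ξ‖))
    isClosed_extensions ?_
  intro F hF a _ η _ ξ _
  obtain ⟨K, _, _, _, ρ, V, hρ, hV, -, hiso⟩ := exists_dilation_of_mem_extensions hA h1 hπ1 hF
  rw [mem_closedBall_zero_iff, hV]
  calc ‖inner ℂ (V η) (ρ a (V ξ))‖ ≤ ‖V η‖ * ‖ρ a (V ξ)‖ := norm_inner_le_norm _ _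
    _ ≤ ‖V η‖ * (p l a * ‖V ξ‖) := by
      gcongr
      exact (ρ a).le_of_opNorm_le (hρ a) _
    _ = p l a * ‖η‖ * ‖ξ‖ := by rw [hiso, hiso]; ring

end Extensions

/-! ### Testing irreducibility on self-adjoint operators. -/

section Irreducible

variable {K : Type*} [NormedAddCommGroup K] [InnerProductSpace ℂ K] [CompleteSpace K]

/-- A self-adjoint perturbation of norm at most `1/4` keeps `1/2` above `1/4`. This lower bound
later keeps the scalar given by purity away from `0` and `1`. -/
theorem isPositive_half_add_smul {T : K →L[ℂ] K} (hT : IsSelfAdjoint T) {ε : ℝ}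
    (hε : |ε| * ‖T‖ ≤ 1 / 4) (x : K) :
    ((1 / 2 : ℂ) • (1 : K →L[ℂ] K) + (ε : ℂ) • T).IsPositive ∧
      1 / 4 * ‖x‖ ^ 2 ≤ (inner ℂ x (((1 / 2 : ℂ) • (1 : K →L[ℂ] K) + (ε : ℂ) • T) x)).re := by
  have key : ∀ x, 1 / 4 * ‖x‖ ^ 2 ≤
      (inner ℂ x (((1 / 2 : ℂ) • (1 : K →L[ℂ] K) + (ε : ℂ) • T) x)).re := by
    intro x
    have h1 : |(inner ℂ x (T x)).re| ≤ ‖T‖ * ‖x‖ ^ 2 := by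
      refine (Complex.abs_re_le_norm _).trans ((norm_inner_le_norm _ _).trans ?_)
      have := T.le_opNorm x
      nlinarith [norm_nonneg x]
    have h2 : |ε * (inner ℂ x (T x)).re| ≤ 1 / 4 * ‖x‖ ^ 2 := by
      rw [abs_mul]
      nlinarith [abs_nonneg ε, sq_nonneg ‖x‖]
    have h3 : (inner ℂ x (((1 / 2 : ℂ) • (1 : K →L[ℂ] K) + (ε : ℂ) • T) x)).re =
        1 / 2 * ‖x‖ ^ 2 + ε * (inner ℂ x (T x)).re := by
      rw [add_apply, smul_apply, smul_apply, inner_add_right, inner_smul_right, inner_smul_right,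
        one_apply_eq_self, inner_self_eq_norm_sq_to_K, Complex.add_re, Complex.re_ofReal_mul]
      congr 1
      have : (1 / 2 : ℂ) * ((‖x‖ : ℂ)) ^ 2 = ((1 / 2 * ‖x‖ ^ 2 : ℝ) : ℂ) := by push_cast; ring
      exact (congrArg Complex.re this).trans (Complex.ofReal_re _)
    rw [h3]
    linarith [neg_le_of_abs_le h2]
  refine ⟨ContinuousLinearMap.isPositive_def'.2 ⟨?_, fun x => ?_⟩, key x⟩
  · refine IsSelfAdjoint.add ?_ ?_
    · exact IsSelfAdjoint.smul (by simp [IsSelfAdjoint]) (.one _)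
    · exact IsSelfAdjoint.smul (Complex.conj_ofReal ε) hT
  · rw [ContinuousLinearMap.reApplyInnerSelf_apply, inner_re_symm]
    exact le_trans (by positivity) (key x)

/-- To see that a self-adjoint family of operators is irreducible, it suffices to test
self-adjoint operators in the commutant. -/
theorem exists_eq_smul_one_of_isSelfAdjoint {A : Type*} [Ring A] [StarRing A] [Algebra ℂ A]
    (ρ : A →⋆ₐ[ℂ] (K →L[ℂ] K))
    (h : ∀ T : K →L[ℂ] K, IsSelfAdjoint T → (∀ a, T * ρ a = ρ a * T) → ∃ c : ℂ, T = c • 1)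
    {T : K →L[ℂ] K} (hT : ∀ a, T * ρ a = ρ a * T) : ∃ c : ℂ, T = c • 1 := by
  have hT' : ∀ a, star T * ρ a = ρ a * star T := fun a => by
    have := congrArg star (hT (star a))
    rw [star_mul, star_mul, ← map_star, star_star] at this
    exact this.symm
  obtain ⟨c, hc⟩ := h (T + star T) (by simp [IsSelfAdjoint, add_comm]) fun a => by
    rw [add_mul, mul_add, hT, hT']
  obtain ⟨d, hd⟩ := h (Complex.I • (T - star T)) (by
    simp [IsSelfAdjoint, star_smul, sub_eq_add_neg, add_comm]) fun a => by
    rw [smul_mul_assoc, mul_smul_comm, sub_mul, mul_sub, hT, hT']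
  refine ⟨(1 / 2 : ℂ) * (c - Complex.I * d), ?_⟩
  have h1 : T = (1 / 2 : ℂ) • ((T + star T) - Complex.I • (Complex.I • (T - star T))) := by
    rw [smul_smul, Complex.I_mul_I, neg_one_smul, sub_neg_eq_add, add_add_sub_cancel, ← two_smul ℂ,
      smul_smul]
    norm_num
  rw [h1, hc, hd, smul_smul, ← sub_smul, smul_smul]

end Irreducible

/-! ### Purity, finiteness and separation give a boundary representation. -/

section Backward

variable {A : Type u} [Ring A] [StarRing A] [Algebra ℂ A] {Λ : Type v} {p : Λ → Seminorm ℂ A}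
  {l : Λ} {H : Type w} [NormedAddCommGroup H] [InnerProductSpace ℂ H] [CompleteSpace H]
  {S : Submodule ℂ A} {π : A →⋆ₐ[ℂ] (H →L[ℂ] H)}

theorem IsLocalRep.continuous [TopologicalSpace A] [IsTopologicalAddGroup A]
    (hp : WithSeminorms p) (hπ : IsLocalRep p π) : Continuous π := by
  obtain ⟨l, hl⟩ := hπ
  refine continuous_of_continuousAt_zero π ?_
  rw [ContinuousAt, map_zero, tendsto_zero_iff_norm_tendsto_zero]
  refine squeeze_zero (fun _ => norm_nonneg _) hl ?_
  simpa using (hp.continuous_seminorm l).tendsto 0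

/-- A unitary commuting with a local representation on a generating set lies in its commutant. -/
theorem IsLocalRep.commute_of_generates [TopologicalSpace A] [IsTopologicalAddGroup A]
    [StarModule ℂ A] (hp : WithSeminorms p) (hπ : IsLocalRep p π) (hgen : Generates S)
    {W : H →L[ℂ] H} (hW : W ∈ unitary (H →L[ℂ] H)) (hS : ∀ a ∈ S, W * π a = π a * W) (a : A) :
    W * π a = π a * W := by
  -- Unitarity yields commutation with `star W` as well, so the commutant of `W` is a *-subalgebra.
  have hstar : ∀ T : H →L[ℂ] H, W * T = T * W → star W * T = T * star W := fun T hT => by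
    calc star W * T = star W * (T * W) * star W := by
          rw [mul_assoc, mul_assoc, Unitary.mul_star_self_of_mem hW, mul_one]
      _ = T * star W := by rw [← hT, ← mul_assoc, Unitary.star_mul_self_of_mem hW, one_mul]
  have hmem : ∀ T : H →L[ℂ] H, T ∈ StarSubalgebra.centralizer ℂ {W} ↔ W * T = T * W := by
    intro T
    rw [StarSubalgebra.mem_centralizer_iff]
    simp only [Set.mem_singleton_iff, forall_eq]
    exact ⟨fun h => h.1, fun h => ⟨h, hstar T h⟩⟩
  have hle : StarAlgebra.adjoin ℂ (S : Set A) ≤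
      (StarSubalgebra.centralizer ℂ {W}).comap π :=
    StarAlgebra.adjoin_le fun s hs => (hmem _).2 (hS s hs)
  have hcont := hπ.continuous hp
  have hclosed : IsClosed {a : A | W * π a = π a * W} :=
    isClosed_eq (continuous_const.mul hcont) (hcont.mul continuous_const)
  exact hclosed.closure_subset_iff.2 (fun b hb => (hmem _).1 (hle hb)) (hgen a)

/-- Purity forces the minimal dilations of extreme extensions to be irreducible. -/
theorem isIrreducible_of_mem_extremePoints [Nontrivial H] (h1 : (1 : A) ∈ S)
    (hpure : IsPureLocalCP p (restrict π S)) {F : A → H → H → ℂ}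
    (hF : F ∈ (extensions p l S π).extremePoints ℝ) {K : Type*} [NormedAddCommGroup K]
    [InnerProductSpace ℂ K] [CompleteSpace K] {ρ : A →⋆ₐ[ℂ] (K →L[ℂ] K)} {V : H →L[ℂ] K}
    (hρ : ∀ a, ‖ρ a‖ ≤ p l a) (hV : ∀ a η ξ, F a η ξ = inner ℂ (V η) (ρ a (V ξ)))
    (hd : Dense (Submodule.span ℂ (Set.range fun x : A × H => ρ x.1 (V x.2)) : Set K))
    (hiso : ∀ ξ, ‖V ξ‖ = ‖ξ‖) : IsIrreducibleLocalRep p ρ := by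
  refine ⟨⟨l, hρ⟩, fun T₀ hT₀ => exists_eq_smul_one_of_isSelfAdjoint ρ (fun T hT hc => ?_) hT₀⟩
  obtain ⟨ξ₀, hξ₀⟩ := exists_ne (0 : H)
  have hξpos : 0 < ‖ξ₀‖ ^ 2 := by have := norm_pos_iff.2 hξ₀; positivity
  have hFS : ∀ (s : S) η ξ, inner ℂ (V η) (ρ s (V ξ)) = inner ℂ η (π s ξ) := fun s η ξ => by
    rw [← hV]
    exact hF.1.2 s s.2 η ξ
  -- Small enough for `1/2 ± εT ≥ 1/4`; the `+ 1` allows `T = 0`.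
  set ε : ℝ := 1 / (4 * (‖T‖ + 1)) with hε
  have hεpos : 0 < ε := by positivity
  have hεT : ε * ‖T‖ ≤ 1 / 4 := by
    rw [hε, div_mul_eq_mul_div, div_le_div_iff₀ (by positivity) (by norm_num)]
    linarith
  have hpos₁ := isPositive_half_add_smul hT (ε := ε) (by rwa [abs_of_pos hεpos])
  have hpos₂ := isPositive_half_add_smul hT (ε := -ε) (by rwa [abs_neg, abs_of_pos hεpos])
  set T₁ : K →L[ℂ] K := (1 / 2 : ℂ) • 1 + (ε : ℂ) • T with hT₁
  set T₂ : K →L[ℂ] K := (1 / 2 : ℂ) • 1 + ((-ε : ℝ) : ℂ) • T with hT₂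
  have hadd : ∀ x, T₁ x + T₂ x = x := fun x => by
    simp only [hT₁, hT₂, add_apply, smul_apply, one_apply_eq_self, Complex.ofReal_neg,
      neg_smul, neg_apply]
    rw [add_add_add_comm, add_neg_cancel, add_zero, ← add_smul]
    norm_num
  have hc₁ : ∀ a, T₁ * ρ a = ρ a * T₁ := fun a => by
    simp only [hT₁, add_mul, mul_add, smul_mul_assoc, mul_smul_comm, one_mul, mul_one, hc]
  have hc₂ : ∀ a, T₂ * ρ a = ρ a * T₂ := fun a => by
    simp only [hT₂, add_mul, mul_add, smul_mul_assoc, mul_smul_comm, one_mul, mul_one, hc]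
  have hdiff : restrict π S - compression S ρ T₁ V = compression S ρ T₂ V := by
    ext s ξ
    refine ext_inner_left ℂ fun η => ?_
    rw [LinearMap.sub_apply, sub_apply, inner_sub_right, inner_compression, inner_compression,
      sub_eq_iff_eq_add, ← inner_add_right, add_comm, hadd, hFS]
    rfl
  -- The compressions by `T₁` and `T₂` are CP on `S` with sum `π|_S`, so purity makes the first `t`
  -- times it.
  obtain ⟨t, -, -, ht⟩ := hpure.2 (compression S ρ T₁ V)
    ⟨l, isCPAt_compression hρ (hpos₁ 0).1 hc₁ V⟩
    (hdiff ▸ ⟨l, isCPAt_compression hρ (hpos₂ 0).1 hc₂ V⟩)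
  have hS₁ : ∀ (s : S) η ξ, inner ℂ (V η) (T₁ (ρ s (V ξ))) = (t : ℂ) * inner ℂ η (π s ξ) := by
    intro s η ξ
    rw [← inner_compression, ht, LinearMap.smul_apply, smul_apply, inner_smul_right]
    rfl
  have hS₂ : ∀ (s : S) η ξ,
      inner ℂ (V η) (T₂ (ρ s (V ξ))) = ((1 - t : ℝ) : ℂ) * inner ℂ η (π s ξ) := by
    intro s η ξ
    have h := hFS s η ξ
    rw [← hadd (ρ s (V ξ)), inner_add_right, hS₁] at h
    push_cast
    linear_combination h
  have hlower : ∀ (R : K →L[ℂ] K) (r : ℝ), 1 / 4 * ‖V ξ₀‖ ^ 2 ≤ (inner ℂ (V ξ₀) (R (V ξ₀))).re →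
      (∀ (s : S) η ξ, inner ℂ (V η) (R (ρ s (V ξ))) = (r : ℂ) * inner ℂ η (π s ξ)) → 0 < r := by
    intro R r hR hr
    have h := hr ⟨1, h1⟩ ξ₀ ξ₀
    rw [map_one, map_one, one_apply_eq_self, one_apply_eq_self] at h
    rw [h, Complex.re_ofReal_mul, hiso] at hR
    have h2 : (inner ℂ ξ₀ ξ₀ : ℂ).re = ‖ξ₀‖ ^ 2 := inner_self_eq_norm_sq (𝕜 := ℂ) ξ₀
    rw [h2] at hR
    have := le_of_mul_le_mul_right hR hξpos
    linarith
  have ht0 := hlower T₁ t (hpos₁ _).2 hS₁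
  have ht1 := hlower T₂ (1 - t) (hpos₂ _).2 hS₂
  have hmem : ∀ (R : K →L[ℂ] K) (r : ℝ), 0 < r → R.IsPositive → (∀ a, R * ρ a = ρ a * R) →
      (∀ (s : S) η ξ, inner ℂ (V η) (R (ρ s (V ξ))) = (r : ℂ) * inner ℂ η (π s ξ)) →
      (r⁻¹ • fun a η ξ => inner ℂ (V η) (R (ρ a (V ξ)))) ∈ extensions p l S π := by
    intro R r hr hR hRc hRS
    refine ⟨(isPositiveForm_compression hρ hR hRc V).real_smul (inv_nonneg.2 hr.le),
      fun s hs η ξ => ?_⟩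
    change r⁻¹ • inner ℂ (V η) (R (ρ s (V ξ))) = _
    rw [hRS ⟨s, hs⟩, ← Complex.real_smul, smul_smul, inv_mul_cancel₀ hr.ne', one_smul]
  -- `F` is the combination, with weights `t` and `1 - t`, of the two normalised pieces; extremality
  -- identifies the first piece with `F`.
  have hext := hF.2 (hmem T₁ t ht0 (hpos₁ 0).1 hc₁ hS₁)
    (hmem T₂ (1 - t) ht1 (hpos₂ 0).1 hc₂ hS₂) ⟨t, 1 - t, ht0, ht1, by ring, by
      rw [smul_smul, smul_smul, mul_inv_cancel₀ ht0.ne', mul_inv_cancel₀ ht1.ne', one_smul,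
        one_smul]
      ext a η ξ
      simp only [Pi.add_apply]
      rw [← inner_add_right, hadd, hV]⟩
  -- Minimality of the dilation turns this equality of forms into one of operators.
  have hscalar : T₁ = (t : ℂ) • 1 := by
    refine ext_of_dense_span hd ?_
    rintro _ ⟨⟨b, η⟩, rfl⟩ _ ⟨⟨c, ξ⟩, rfl⟩
    have h2 : ∀ x, inner ℂ (ρ b (V η)) x = inner ℂ (V η) (ρ (star b) x) := fun x => by
      rw [map_star, ContinuousLinearMap.star_eq_adjoint, ContinuousLinearMap.adjoint_inner_right]
    have h3 : ρ (star b) (T₁ (ρ c (V ξ))) = T₁ (ρ (star b * c) (V ξ)) := by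
      rw [map_mul]
      exact (congrArg (fun R : K →L[ℂ] K => R (ρ c (V ξ))) (hc₁ (star b))).symm
    have h4 := congrFun (congrFun (congrFun hext (star b * c)) η) ξ
    change t⁻¹ • inner ℂ (V η) (T₁ (ρ (star b * c) (V ξ))) = _ at h4
    rw [inv_smul_eq_iff₀ ht0.ne', hV, Complex.real_smul] at h4
    change inner ℂ (ρ b (V η)) (T₁ (ρ c (V ξ))) =
      inner ℂ (ρ b (V η)) (((t : ℂ) • (1 : K →L[ℂ] K)) (ρ c (V ξ)))
    rw [h2, h3, h4, smul_apply, one_apply_eq_self, inner_smul_right, h2, map_mul,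
      mul_apply_eq_comp]
  refine ⟨(ε : ℂ)⁻¹ * (t - 1 / 2), ?_⟩
  have hε0 : (ε : ℂ) ≠ 0 := by exact_mod_cast hεpos.ne'
  have h5 : (ε : ℂ) • T = ((t : ℂ) - 1 / 2) • (1 : K →L[ℂ] K) := by
    rw [sub_smul, ← hscalar, hT₁, add_sub_cancel_left]
  rw [mul_smul, ← h5, smul_smul, inv_mul_cancel₀ hε0, one_smul]

variable [StarModule ℂ A] [UniformSpace A] [IsUniformAddGroup A] [PartialOrder Λ]

/-- Purity makes the minimal dilation irreducible, separation moves it onto `π`, and finiteness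
makes the transported isometry `W` unitary. -/
theorem eq_of_mem_extremePoints [Nontrivial H] (hA : IsLocallyCStarAlgebra p)
    (hS : IsLocalOperatorSystem S) (hgen : Generates S) (hπ : IsLocalRep p π)
    (hpure : IsPureLocalCP p (restrict π S)) (hfin : IsFiniteLocalRep p S π)
    (hsep : Separates p S π) {F : A → H → H → ℂ}
    (hF : F ∈ (extensions p l S π).extremePoints ℝ) (a : A) (η ξ : H) :
    F a η ξ = inner ℂ η (π a ξ) := by
  obtain ⟨K, _, _, _, ρ, V, hρ, hV, hd, hiso⟩ :=
    exists_dilation_of_mem_extensions hA hS.one_mem (map_one π) hF.1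
  have hirr := isIrreducible_of_mem_extremePoints hS.one_mem hpure hF hρ hV hd hiso
  obtain ⟨U, hU⟩ := hsep K ρ V hirr ((AddMonoidHomClass.isometry_iff_norm V).2 hiso)
    fun s hs => by
      ext ξ
      refine ext_inner_left ℂ fun η => ?_
      rw [inner_adjoint_comp_comp, ← hV, hF.1.2 s hs]
  set W : H →L[ℂ] H := (U.symm : K →L[ℂ] H) ∘L V with hWdef
  have hWV : ∀ ξ, U (W ξ) = V ξ := fun ξ => U.apply_symm_apply (V ξ)
  have hFW : ∀ a η ξ, F a η ξ = inner ℂ (W η) (π a (W ξ)) := fun a η ξ => by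
    rw [hV, ← U.inner_map_map, hU, hWV, hWV]
  have hW := hfin.2 W ((AddMonoidHomClass.isometry_iff_norm W).2 fun ξ => by
    rw [← U.norm_map, hWV, hiso]) fun s hs => by
      ext ξ
      refine ext_inner_left ℂ fun η => ?_
      rw [inner_adjoint_comp_comp, ← hFW, hF.1.2 s hs]
  -- For unitary `W`, the relation `W⋆ π(s) W = π(s)` is commutation on `S`, and generation carries
  -- it to `A`.
  have hcomm := hπ.commute_of_generates hA.withSeminorms hgen hW (fun s hs => by
    have h : star W * (π s * W) = π s := by
      ext ξ
      refine ext_inner_left ℂ fun η => ?_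
      rw [← hF.1.2 s hs, hFW]
      exact inner_adjoint_comp_comp (π s) W η ξ
    calc W * π s = (W * star W) * (π s * W) := by rw [mul_assoc, h]
      _ = π s * W := by rw [Unitary.mul_star_self_of_mem hW, one_mul]) a
  have h2 : star W * (π a * W) = π a := by
    rw [← hcomm, ← mul_assoc, Unitary.star_mul_self_of_mem hW, one_mul]
  rw [hFW]
  conv_rhs => rw [← h2]
  exact (inner_adjoint_comp_comp (π a) W η ξ).symm

/-- The seminorm is the one of the competing extension `ψ`; no comparison with a seminorm bounding
`π` is needed. -/
theorem isLocalBoundaryRep_of_pure_finite_separates [Nontrivial H]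
    (hA : IsLocallyCStarAlgebra p) (hS : IsLocalOperatorSystem S) (hgen : Generates S)
    (hπ : IsIrreducibleLocalRep p π) (hpure : IsPureLocalCP p (restrict π S))
    (hfin : IsFiniteLocalRep p S π) (hsep : Separates p S π) : IsLocalBoundaryRep p S π := by
  refine ⟨hπ, hπ.1.isLocalCP_restrict ⊤, fun ψ hψ hψS => ?_⟩
  obtain ⟨l, hl⟩ := hψ
  have hl : IsCPAt p l ψ := hl
  set F : A → H → H → ℂ := fun a η ξ => inner ℂ η (ψ ⟨a, trivial⟩ ξ) with hFdef
  have hF : F ∈ extensions p l S π := by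
    refine ⟨⟨fun a b η ξ => ?_, fun c a η ξ => ?_, fun a η ξ ξ' => ?_, fun c a η ξ => ?_,
      fun a η ξ => ?_, fun n M hM ξ => ?_⟩, fun s hs η ξ => ?_⟩
    · simp only [hFdef]
      rw [← inner_add_right, ← add_apply, ← map_add]
      rfl
    · simp only [hFdef]
      rw [← inner_smul_right, ← smul_apply, ← map_smul]
      rfl
    · simp only [hFdef, map_add, inner_add_right]
    · simp only [hFdef, map_smul, inner_smul_right]
    · have h := hl.map_star hA ⟨Submodule.mem_top, fun _ _ => Submodule.mem_top⟩ ⟨a, trivial⟩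
      simp only [hFdef]
      rw [h, ContinuousLinearMap.star_eq_adjoint, ContinuousLinearMap.adjoint_inner_right]
      exact inner_conj_symm _ _
    · exact (hl n (M.map fun a => ⟨a, trivial⟩)).1 hM ξ
    · simp only [hFdef]
      rw [hψS ⟨s, trivial⟩ hs]
  -- By Krein–Milman the set containing `F` is the closed convex hull of its extreme points, all
  -- equal to the form of `π`.
  have hKM := closure_convexHull_extremePoints
    (isCompact_extensions hA hS.one_mem (map_one π) (p := p) (l := l))
    (convex_extensions (p := p) (l := l) (S := S) (π := π))
  have hsub : (extensions p l S π).extremePoints ℝ ⊆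
      {fun a η ξ => inner ℂ η (π a ξ)} := fun G hG => by
    rw [Set.mem_singleton_iff]
    ext a η ξ
    exact eq_of_mem_extremePoints hA hS hgen hπ.1 hpure hfin hsep hG a η ξ
  have hF' := closure_mono (convexHull_min hsub (convex_singleton _)) (hKM ▸ hF)
  rw [closure_singleton, Set.mem_singleton_iff] at hF'
  ext a ξ
  refine ext_inner_left ℂ fun η => ?_
  exact congrFun (congrFun (congrFun hF' (a : A)) η) ξ

end Backward

end LocalCStar

theorem mainTheorem1 {A : Type*} [Ring A] [StarRing A] [Algebra ℂ A] [StarModule ℂ A]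
    [UniformSpace A] [IsUniformAddGroup A] {Λ : Type*} [PartialOrder Λ]
    (p : Λ → Seminorm ℂ A) (hA : LocalCStar.IsLocallyCStarAlgebra p)
    (S : Submodule ℂ A) (hS : LocalCStar.IsLocalOperatorSystem S)
    (hgen : LocalCStar.Generates S)
    {H : Type*} [NormedAddCommGroup H] [InnerProductSpace ℂ H] [CompleteSpace H] [Nontrivial H]
    (π : A →⋆ₐ[ℂ] (H →L[ℂ] H)) (hπ : LocalCStar.IsIrreducibleLocalRep p π) :
    LocalCStar.IsLocalBoundaryRep p S π ↔
      LocalCStar.IsPureLocalCP p (LocalCStar.restrict π S) ∧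
      LocalCStar.IsFiniteLocalRep p S π ∧
      LocalCStar.Separates p S π :=
  ⟨fun hb => ⟨hb.isPureLocalCP hA hS, hb.isFiniteLocalRep, hb.separates⟩, fun h =>
    LocalCStar.isLocalBoundaryRep_of_pure_finite_separates hA hS hgen hπ h.1 h.2.1 h.2.2⟩
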